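/- There exist a word-RAM program $P$ and constants $c, C, T \in \mathbb{N}$ such that the following holds for every square-free word $v$ of length $n$ over an arbitrary alphabet, and for every word size $w$ with $2^w \ge c\,(n+1)$ (that is, $w \ge \log_2 (n+1) + O(1)$). (A word is square-free if it has no subword of the form $uu$ with $u$ non-empty.) There exists a data structure for $v$ of size $O(n)$, namely a sequence of at most $C\,n$ machine words of $w$ bits each, such that $P$, with this data structure in memory, answers every Internal Pattern Matching query for $v$ in $O(1)$ time, namely in at most $T$ steps of the word RAM, and leaves the data structure intact. An Internal Pattern Matching query is: given the positions $1 \le \ell \le r \le n$ and $1 \le \ell' \le r' \le n$ of two subwords $x = v[\ell] \cdots v[r]$ and $y = v[\ell'] \cdots v[r']$ of $v$ with $|y| \le 2|x|$, report the set of all positions of $y$ at which $x$ occurs, represented as an arithmetic progression (first term, difference, number of terms). No bound on the construction time of the data structure is claimed. Here the word RAM has words that are integers in $[0, 2^w)$; in unit time it performs one of: loading a constant, addition, subtraction, multiplication, division, remainder, bitwise and / or / xor, left or right shift (all in $w$-bit arithmetic), reading or writing the memory cell whose address is in a register, and jumps, also conditional on the comparison of two registers. The program $P$ does not depend on $v$,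 $n$ or $w$. -/

import Mathlib

/-! ### Words -/

namespace IPM

/-- A word is square-free if no square `u u` with `u` non-empty is a (contiguous) subword of it. -/
def SquareFree {α : Type*} (v : List α) : Prop :=
  ∀ u : List α, u ≠ [] → ¬ (u ++ u) <:+: v

/-- The fragment `v[i, j] = v[i] v[i+1] ... v[j]`, where positions are numbered from `1`.
Used for `1 ≤ i ≤ j ≤ |v|`; its length is then `j - i + 1`. -/
def fragment {α : Type*} (v : List α) (i j : ℕ) : List α :=
  (v.drop (i - 1)).take (j + 1 - i)

/-- The set of positions (numbered from `1`) at which the word `x` occurs in the word `y`. -/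
def occurrences {α : Type*} (x y : List α) : Set ℕ :=
  {p | ∃ s t : List α, y = s ++ x ++ t ∧ p = s.length + 1}

/-- The triple `(a, d, m)` represents the set `S` as the arithmetic progression
`a, a + d, ..., a + (m - 1) d` with `m` distinct terms. -/
def RepresentsAP (a d m : ℕ) (S : Set ℕ) : Prop :=
  S = {p | ∃ i, i < m ∧ p = a + i * d} ∧ (2 ≤ m → 0 < d)

end IPM

/-! ### The word RAM

A machine with `w`-bit words (natural numbers below `2 ^ w`), registers `0, 1, 2, ...`,
of which a program names only finitely many, and a memory of words addressed by words.
Every instruction takes one unit of time. -/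

namespace WordRAM

/-- Binary operations on words. -/
inductive Op where
  | add | sub | mul | div | mod | and | or | xor | shl | shr

/-- The result of an operation, in `w`-bit arithmetic. Addition, subtraction, multiplication and
left shift are taken modulo `2 ^ w`; division by zero gives zero. -/
def Op.eval (w : ℕ) : Op → ℕ → ℕ → ℕ
  | .add, x, y => (x + y) % 2 ^ w
  | .sub, x, y => (x + (2 ^ w - y % 2 ^ w)) % 2 ^ w
  | .mul, x, y => (x * y) % 2 ^ w
  | .div, x, y => (x / y) % 2 ^ w
  | .mod, x, y => (x % y) % 2 ^ w
  | .and, x, y => (x &&& y) % 2 ^ w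
  | .or, x, y => (x ||| y) % 2 ^ w
  | .xor, x, y => (x ^^^ y) % 2 ^ w
  | .shl, x, y => (x <<< y) % 2 ^ w
  | .shr, x, y => (x >>> y) % 2 ^ w

/-- Instructions. Register numbers, constants and jump targets are fixed in the program. -/
inductive Instr where
  /-- `R[d] := c` -/
  | const (d c : ℕ)
  /-- `R[d] := op R[a] R[b]` -/
  | op (o : Op) (d a b : ℕ)
  /-- `R[d] := M[R[a]]` -/
  | load (d a : ℕ)
  /-- `M[R[a]] := R[b]` -/
  | store (a b : ℕ)
  /-- unconditional jump to instruction `t` -/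
  | jump (t : ℕ)
  /-- jump to instruction `t` if `R[a] = R[b]` -/
  | jumpEq (a b t : ℕ)
  /-- jump to instruction `t` if `R[a] < R[b]` -/
  | jumpLt (a b t : ℕ)
  /-- stop -/
  | halt

/-- A program is a finite list of instructions, numbered from `0`. -/
abbrev Program := List Instr

/-- A configuration: program counter, registers and memory. -/
structure Config where
  pc : ℕ
  reg : ℕ → ℕ
  mem : ℕ → ℕ

/-- The machine has stopped: the program counter is at a `halt` or outside the program. -/
def Halted (P : Program) (c : Config) : Prop :=
  P[c.pc]? = none ∨ P[c.pc]? = some Instr.halt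

/-- The effect of one instruction on a configuration. -/
def Instr.exec (w : ℕ) : Instr → Config → Config
  | .const d k, c => ⟨c.pc + 1, Function.update c.reg d (k % 2 ^ w), c.mem⟩
  | .op o d a b, c =>
      ⟨c.pc + 1, Function.update c.reg d (o.eval w (c.reg a) (c.reg b)), c.mem⟩
  | .load d a, c => ⟨c.pc + 1, Function.update c.reg d (c.mem (c.reg a)), c.mem⟩
  | .store a b, c => ⟨c.pc + 1, c.reg, Function.update c.mem (c.reg a) (c.reg b)⟩
  | .jump t, c => ⟨t, c.reg, c.mem⟩
  | .jumpEq a b t, c => ⟨if c.reg a = c.reg b then t else c.pc + 1, c.reg, c.mem⟩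
  | .jumpLt a b t, c => ⟨if c.reg a < c.reg b then t else c.pc + 1, c.reg, c.mem⟩
  | .halt, c => c

/-- One step of the machine; a configuration that has halted stays as it is. -/
def step (w : ℕ) (P : Program) (c : Config) : Config :=
  match P[c.pc]? with
  | none => c
  | some i => i.exec w c

/-- The configuration after `t` steps. -/
def run (w : ℕ) (P : Program) (t : ℕ) (c : Config) : Config :=
  (step w P)^[t] c

/-- The start configuration for the arguments `args`, which are put into the registers
`0, 1, ...` (all other registers are zero), with the data structure `D` in the memory cells
`0, ..., |D| - 1` (all other cells are zero). -/
def start (D args : List ℕ) : Config :=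
  ⟨0, fun i => args.getD i 0, fun i => D.getD i 0⟩

end WordRAM

namespace IPM

/-- With the data structure `D` in memory, on a machine with `w`-bit words, the query program `P`
answers in at most `T` steps every internal pattern matching query for the word `v`: given the
end-positions of two fragments `x = v[l, r]` and `y = v[l', r']` with `|y| ≤ 2 |x|`, it stops with
the set of all positions in `y` at which `x` occurs represented as an arithmetic progression in
the registers `0, 1, 2`, and with the data structure intact. -/
def AnswersQueries {α : Type*} (w : ℕ) (P : WordRAM.Program) (T : ℕ) (D : List ℕ)
    (v : List α) : Prop :=
  ∀ l r l' r' : ℕ, 1 ≤ l → l ≤ r → r ≤ v.length → 1 ≤ l' → l' ≤ r' → r' ≤ v.length →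
    (fragment v l' r').length ≤ 2 * (fragment v l r).length →
    ∃ t ≤ T, ∃ c : WordRAM.Config,
      c = WordRAM.run w P t (WordRAM.start D [l, r, l', r']) ∧
      WordRAM.Halted P c ∧
      c.mem = (WordRAM.start D [l, r, l', r']).mem ∧
      RepresentsAP (c.reg 0) (c.reg 1) (c.reg 2)
        (occurrences (fragment v l r) (fragment v l' r'))

end IPM

/-! In a square-free word, two equal fragments of length `L` start more than `L` apart: at a
distance `D ≤ L` the first `D` letters of both would form a square. Hence a text at most twice as
long as the pattern contains it at most once, and a query has to find a single position or refute
it.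

To find it, fix a level `m = 2 ^ k` proportional to the pattern length. By square-freeness, the
fragments of length `m` at distinct positions less than `m` apart are distinct. Under a random
ranking of these fragments a position is therefore least in some window of `m` positions with
probability at most `4 / m`, so some ranking leaves at most `4 n / m` such samples
(`SquareFree.exists_sampling`). Over all levels this sums to `O(n)`. The choice is local: it depends
only on the `2 m - 1` letters from the start of the window, so every occurrence of the pattern has a
sample at the same offset. Equal fragments of length `m` cannot start twice in one block of `m`
positions, so fragment and block number together determine the sample. A linear-size dictionary,
built by random shifts and greedy row displacement (`exists_dictionary`), stores these samples, and
13 lookups cover the text (`SquareFree.exists_index`).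

A lookup with an absent key returns an arbitrary value, so each candidate is verified. Fragments are
compared by evaluating their polynomials at a point of the field with `p ^ 8` elements that
separates all fragments of the word (`exists_fingerprint`). With `p` of order `√n`, the field is
large enough for such a point, while products of coordinates modulo `p` are `O(n)` and fit into a
word. The whole query is one fixed expression without loops, so its running time is bounded by the
length of its code. -/

namespace WordRAM

/-! ### Compiling expressions to word-RAM code -/

/-- Expressions over the four arguments of a query and the memory; they are evaluated on the word
RAM by code that writes no memory cell. -/
inductive Expr where
  | const (k : ℕ)
  | arg (i : Fin 4)
  | op (o : Op) (a b : Expr)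
  | lt (a b : Expr)
  | load (a : Expr)

/-- The value of an expression in `w`-bit arithmetic. -/
def Expr.eval (w : ℕ) (mem args : ℕ → ℕ) : Expr → ℕ
  | .const k => k % 2 ^ w
  | .arg i => args i % 2 ^ w
  | .op o a b => o.eval w (a.eval w mem args) (b.eval w mem args)
  | .lt a b => if a.eval w mem args < b.eval w mem args then 1 % 2 ^ w else 0
  | .load a => mem (a.eval w mem args)

/-- Code which, placed at address `p`, evaluates an expression into register `d`; it changes no
register below `d`. -/
def Expr.compile : Expr → ℕ → ℕ → Program
  | .const k, _, d => [.const d k]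
  | .arg i, _, d => [.op .or d i i]
  | .op o a b, p, d =>
      a.compile p d ++ (b.compile (p + (a.compile p d).length) (d + 1) ++ [.op o d d (d + 1)])
  | .lt a b, p, d =>
      a.compile p d ++ (b.compile (p + (a.compile p d).length) (d + 1) ++
        let q := p + (a.compile p d).length +
          (b.compile (p + (a.compile p d).length) (d + 1)).length
        [.jumpLt d (d + 1) (q + 3), .const d 0, .jump (q + 4), .const d 1])
  | .load a, p, d => a.compile p d ++ [.load d d]

/-- The program `P` contains the given code at address `p`. -/
def CodeAt (P : Program) : ℕ → Program → Prop
  | _, [] => True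
  | p, i :: is => P[p]? = some i ∧ CodeAt P (p + 1) is

theorem codeAt_append {P : Program} {p : ℕ} {u v : Program} :
    CodeAt P p (u ++ v) ↔ CodeAt P p u ∧ CodeAt P (p + u.length) v := by
  induction u generalizing p with
  | nil => simp [CodeAt]
  | cons i u ih => simp [CodeAt, ih, and_assoc, Nat.add_assoc, Nat.add_comm 1]

theorem codeAt_middle (pre code post : Program) :
    CodeAt (pre ++ (code ++ post)) pre.length code := by
  induction code generalizing pre with
  | nil => trivial
  | cons i code ih =>
    refine ⟨by simp, ?_⟩
    simpa using ih (pre ++ [i])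

theorem codeAt_self (P : Program) : CodeAt P 0 P := by
  simpa using codeAt_middle [] P []

theorem run_add (w : ℕ) (P : Program) (s t : ℕ) (c : Config) :
    run w P (s + t) c = run w P t (run w P s c) := by
  rw [run, Nat.add_comm, Function.iterate_add_apply]; rfl

theorem run_succ_of_getElem? {w : ℕ} {P : Program} {c : Config} {i : Instr}
    (h : P[c.pc]? = some i) (t : ℕ) : run w P (t + 1) c = run w P t (i.exec w c) := by
  rw [run, Function.iterate_succ_apply]
  simp [step, h, run]

/-- From `c`, within `T` steps, the program `P` arrives at address `q` with `x` in register `d`,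
having changed neither the memory nor the registers below `d`. -/
def Computes (w : ℕ) (P : Program) (T : ℕ) (c : Config) (q d x : ℕ) : Prop :=
  ∃ t ≤ T, (run w P t c).pc = q ∧ (run w P t c).reg d = x ∧
    (∀ i < d, (run w P t c).reg i = c.reg i) ∧ (run w P t c).mem = c.mem

/-- Registers from `d` upwards act as a stack: the second operand is evaluated into `d + 1` and
leaves `d` untouched, while `4 ≤ d` protects the arguments. All jumps go forward, so no instruction
runs twice and the code length bounds the time. -/
theorem Expr.compile_correct (w : ℕ) (P : Program) (mem args : ℕ → ℕ) (e : Expr) :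
    ∀ (d : ℕ) (c : Config), CodeAt P c.pc (e.compile c.pc d) → 4 ≤ d →
      (∀ i < 4, c.reg i = args i) → c.mem = mem →
      Computes w P (e.compile c.pc d).length c (c.pc + (e.compile c.pc d).length) d
        (e.eval w mem args) := by
  induction e with
  | const k =>
    intro d c hc hd ha hm
    refine ⟨1, by simp [compile], ?_⟩
    rw [run_succ_of_getElem? hc.1]
    simp only [run, Function.iterate_zero, id, Instr.exec, compile, List.length_singleton, eval,
      Function.update_self, true_and, and_true]
    intro i hi
    rw [Function.update_of_ne hi.ne]
  | arg i =>
    intro d c hc hd ha hm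
    refine ⟨1, by simp [compile], ?_⟩
    rw [run_succ_of_getElem? hc.1]
    simp only [run, Function.iterate_zero, id, Instr.exec, compile, List.length_singleton, eval,
      Function.update_self, true_and, and_true, Op.eval, Nat.or_self, ha i i.2]
    intro i hi
    rw [Function.update_of_ne hi.ne]
  | op o a b iha ihb =>
    intro d c hc hd ha hm
    simp only [compile, codeAt_append] at hc
    obtain ⟨hca, hcb, hco, -⟩ := hc
    obtain ⟨s, hs, hpc, hreg, hlow, hmem⟩ := iha d c hca hd ha hm
    rw [← hpc] at hcb hco
    obtain ⟨t, ht, hpc', hreg', hlow', hmem'⟩ := ihb (d + 1) (run w P s c) hcb (by omega)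
      (fun i hi => by rw [hlow i (by omega), ha i hi]) (hmem.trans hm)
    rw [← hpc'] at hco
    rw [hpc] at ht hpc'
    refine ⟨s + (t + 1), ?_, ?_⟩
    · simp only [compile, List.length_append, List.length_singleton]; omega
    rw [run_add, run_add, run_succ_of_getElem? hco]
    simp only [run, Function.iterate_zero, id, Instr.exec] at *
    refine ⟨?_, ?_, ?_, ?_⟩
    · simp only [compile, List.length_append, List.length_singleton]; omega
    · simp [eval, hreg', hlow' d (by omega), hreg]
    · intro i hi
      rw [Function.update_of_ne hi.ne, hlow' i (by omega), hlow i hi]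
    · rw [hmem', hmem]
  | lt a b iha ihb =>
    intro d c hc hd ha hm
    simp only [compile, codeAt_append] at hc
    obtain ⟨hca, hcb, h0, h1, h2, h3, -⟩ := hc
    obtain ⟨s, hs, hpc, hreg, hlow, hmem⟩ := iha d c hca hd ha hm
    rw [← hpc] at hcb h0 h1 h2 h3
    obtain ⟨t, ht, hpc', hreg', hlow', hmem'⟩ := ihb (d + 1) (run w P s c) hcb (by omega)
      (fun i hi => by rw [hlow i (by omega), ha i hi]) (hmem.trans hm)
    rw [← hpc'] at h0 h1 h2 h3
    rw [hpc] at ht hpc'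
    by_cases hlt : a.eval w mem args < b.eval w mem args
    · refine ⟨s + (t + 2), ?_, ?_⟩
      · simp only [compile, List.length_append, List.length_cons]; omega
      rw [run_add, run_add, run_succ_of_getElem? h0]
      have e1 : (Instr.jumpLt d (d + 1) ((run w P t (run w P s c)).pc + 3)).exec w
          (run w P t (run w P s c)) = ⟨(run w P t (run w P s c)).pc + 3,
            (run w P t (run w P s c)).reg, (run w P t (run w P s c)).mem⟩ := by
        simp [Instr.exec, hreg', hlow' d (by omega), hreg, hlt]
      rw [e1, run_succ_of_getElem? (i := Instr.const d 1) h3]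
      simp only [run, Function.iterate_zero, id, Instr.exec] at *
      refine ⟨?_, ?_, ?_, ?_⟩
      · simp only [compile, List.length_append, List.length_cons, List.length_nil]; omega
      · simp [eval, hlt]
      · intro i hi
        rw [Function.update_of_ne hi.ne, hlow' i (by omega), hlow i hi]
      · rw [hmem', hmem]
    · refine ⟨s + (t + 3), ?_, ?_⟩
      · simp only [compile, List.length_append, List.length_cons]; omega
      rw [run_add, run_add, run_succ_of_getElem? h0]
      have e1 : (Instr.jumpLt d (d + 1) ((run w P t (run w P s c)).pc + 3)).exec w
          (run w P t (run w P s c)) = ⟨(run w P t (run w P s c)).pc + 1,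
            (run w P t (run w P s c)).reg, (run w P t (run w P s c)).mem⟩ := by
        simp [Instr.exec, hreg', hlow' d (by omega), hreg, hlt]
      rw [e1, run_succ_of_getElem? (i := Instr.const d 0) h1,
        run_succ_of_getElem? (i := Instr.jump ((run w P t (run w P s c)).pc + 4)) h2]
      simp only [run, Function.iterate_zero, id, Instr.exec] at *
      refine ⟨?_, ?_, ?_, ?_⟩
      · simp only [compile, List.length_append, List.length_cons, List.length_nil]; omega
      · simp [eval, hlt]
      · intro i hi
        rw [Function.update_of_ne hi.ne, hlow' i (by omega), hlow i hi]
      · rw [hmem', hmem]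
  | load a iha =>
    intro d c hc hd ha hm
    simp only [compile, codeAt_append] at hc
    obtain ⟨hca, hco, -⟩ := hc
    obtain ⟨s, hs, hpc, hreg, hlow, hmem⟩ := iha d c hca hd ha hm
    rw [← hpc] at hco
    refine ⟨s + 1, ?_, ?_⟩
    · simp only [compile, List.length_append, List.length_singleton]; omega
    rw [run_add, run_succ_of_getElem? hco]
    simp only [run, Function.iterate_zero, id, Instr.exec] at *
    refine ⟨?_, ?_, ?_, ?_⟩
    · simp only [compile, List.length_append, List.length_singleton]; omega
    · simp [eval, hreg, hmem, hm]
    · intro i hi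
      rw [Function.update_of_ne hi.ne, hlow i hi]
    · rw [hmem]

/-- A program that evaluates three expressions into the registers `0, 1, 2`. -/
theorem exists_program (e₀ e₁ e₂ : Expr) : ∃ (P : Program) (T : ℕ), ∀ (w : ℕ) (D args : List ℕ),
    ∃ t ≤ T, ∃ c : Config, c = run w P t (start D args) ∧ Halted P c ∧
      c.mem = (start D args).mem ∧
      c.reg 0 = e₀.eval w (start D args).mem (start D args).reg % 2 ^ w ∧
      c.reg 1 = e₁.eval w (start D args).mem (start D args).reg % 2 ^ w ∧
      c.reg 2 = e₂.eval w (start D args).mem (start D args).reg % 2 ^ w := by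
  let P₀ := e₀.compile 0 4
  let P₁ := e₁.compile P₀.length 5
  let P₂ := e₂.compile (P₀.length + P₁.length) 6
  let P : Program := P₀ ++ (P₁ ++ (P₂ ++ [.op .or 0 4 4, .op .or 1 5 5, .op .or 2 6 6]))
  refine ⟨P, P.length, fun w D args => ?_⟩
  have hP := codeAt_self P
  have hlen : P.length = P₀.length + P₁.length + P₂.length + 3 := by
    simp only [P, List.length_append, List.length_cons, List.length_nil]; omega
  simp only [P, codeAt_append, Nat.zero_add] at hP
  change CodeAt P _ _ ∧ CodeAt P _ _ ∧ CodeAt P _ _ ∧ CodeAt P _ _ at hP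
  obtain ⟨h0, h1, h2, g0, g1, g2, -⟩ := hP
  set c₀ := start D args with hc₀
  obtain ⟨t₀, ht₀, hpc₀, hr₀, hl₀, hm₀⟩ :=
    e₀.compile_correct w P c₀.mem c₀.reg 4 c₀ h0 le_rfl (fun _ _ => rfl) rfl
  have hz : c₀.pc = 0 := rfl
  rw [hz, Nat.zero_add] at hpc₀
  set c₁ := run w P t₀ c₀
  have hp1 : c₁.pc = P₀.length := hpc₀
  obtain ⟨t₁, ht₁, hpc₁, hr₁, hl₁, hm₁⟩ :=
    e₁.compile_correct w P c₀.mem c₀.reg 5 c₁ (by rw [hp1]; exact h1) (by omega)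
      (fun i hi => hl₀ i hi) hm₀
  rw [hp1] at hpc₁ ht₁
  set c₂ := run w P t₁ c₁
  have hp2 : c₂.pc = P₀.length + P₁.length := hpc₁
  obtain ⟨t₂, ht₂, hpc₂, hr₂, hl₂, hm₂⟩ :=
    e₂.compile_correct w P c₀.mem c₀.reg 6 c₂ (by rw [hp2]; exact h2) (by omega)
      (fun i hi => by rw [hl₁ i (by omega), hl₀ i hi]) (hm₁.trans hm₀)
  rw [hp2] at hpc₂ ht₂
  set c₃ := run w P t₂ c₂
  have hp3 : c₃.pc = P₀.length + P₁.length + P₂.length := hpc₂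
  rw [← hp3] at g0 g1 g2
  refine ⟨t₀ + (t₁ + (t₂ + 3)), ?_, _, rfl, ?_⟩
  · change t₀ ≤ P₀.length at ht₀
    change t₁ ≤ P₁.length at ht₁
    change t₂ ≤ P₂.length at ht₂
    omega
  rw [run_add, run_add, run_add, run_succ_of_getElem? g0,
    run_succ_of_getElem? (i := .op .or 1 5 5) g1, run_succ_of_getElem? (i := .op .or 2 6 6) g2]
  have r0 : c₃.reg 4 = e₀.eval w c₀.mem c₀.reg := by
    rw [hl₂ 4 (by omega), hl₁ 4 (by omega), hr₀]
  have r1 : c₃.reg 5 = e₁.eval w c₀.mem c₀.reg := by rw [hl₂ 5 (by omega), hr₁]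
  have r2 : c₃.reg 6 = e₂.eval w c₀.mem c₀.reg := hr₂
  refine ⟨Or.inl ?_, ?_, ?_, ?_, ?_⟩
  · simp only [run, Function.iterate_zero, id, Instr.exec]
    rw [List.getElem?_eq_none]
    rw [hp3]; omega
  · exact hm₂.trans (hm₁.trans hm₀)
  · simp [run, Instr.exec, Op.eval, Function.update, r0]
  · simp [run, Instr.exec, Op.eval, Function.update, r1]
  · simp [run, Instr.exec, Op.eval, Function.update, r2]

end WordRAM

/-! ### Random rankings and sparse minimizers -/

namespace IPM

open Finset

/-- Composing `σ` with the transposition of `c` and `x ∈ Q` moves the minimum over `Q` from `c` to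
`x`. So `x`, and then `σ`, can be recovered from the composite. -/
theorem card_perm_min_mul_le {β : Type*} [Fintype β] [DecidableEq β] [LinearOrder β]
    (Q : Finset β) {c : β} (hc : c ∈ Q) :
    #{σ : Equiv.Perm β | ∀ x ∈ Q, σ c ≤ σ x} * #Q ≤ Fintype.card (Equiv.Perm β) := by
  rw [← card_product, ← card_univ]
  refine card_le_card_of_injOn (fun p => p.1 * Equiv.swap c p.2) (fun _ _ => mem_univ _) ?_
  have key : ∀ (σ : Equiv.Perm β) (x y : β), (∀ z ∈ Q, σ c ≤ σ z) → x ∈ Q → y ∈ Q →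
      (σ * Equiv.swap c x) x ≤ (σ * Equiv.swap c x) y := by
    intro σ x y hσ hx hy
    simp only [Equiv.Perm.mul_apply, Equiv.swap_apply_right]
    refine hσ _ ?_
    rw [Equiv.swap_apply_def]
    split_ifs <;> assumption
  rintro ⟨σ, x⟩ h1 ⟨τ, y⟩ h2 h
  simp only [coe_product, Set.mem_prod, mem_coe, mem_filter, mem_univ, true_and] at h1 h2 h
  have e1 := key σ x y h1.1 h1.2 h2.2
  have e2 := key τ y x h2.1 h2.2 h1.2
  rw [← h] at e2
  have hxy : x = y := (σ * Equiv.swap c x).injective (le_antisymm e1 e2)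
  subst hxy
  rw [mul_right_cancel h]

/-- The position `i` is a position of least weight in a window of `m` positions
below `M`; the weight is the rank `σ` of the class `f`. -/
def IsMinimizer {β : Type*} [LE β] (f : ℕ → β) (σ : Equiv.Perm β) (M m i : ℕ) : Prop :=
  ∃ a, a ≤ i ∧ i < a + m ∧ a + m ≤ M ∧ ∀ j, a ≤ j → j < a + m → σ (f i) ≤ σ (f j)

open Classical in
-- A window of length `m` around `i` contains the half window of length `h = ⌈m / 2⌉` that starts at
-- `i` or the one that ends at `i`. Each consists of `h` distinct classes, so `i` is least in it
-- with probability at most `1 / h ≤ 2 / m`; the union bound gives `4 / m`.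
theorem card_perm_isMinimizer_mul_le {N : ℕ} (f : ℕ → Fin N) (M m : ℕ)
    (hf : ∀ i j, i < j → j < M → j < i + m → f i ≠ f j) (i : ℕ) :
    #{σ : Equiv.Perm (Fin N) | IsMinimizer f σ M m i} * m ≤
      4 * Fintype.card (Equiv.Perm (Fin N)) := by
  set h := (m + 1) / 2 with hh
  have aux : ∀ a, a ≤ i → i < a + h → #{σ : Equiv.Perm (Fin N) | a + h ≤ M ∧
      ∀ j, a ≤ j → j < a + h → σ (f i) ≤ σ (f j)} * h ≤ Fintype.card (Equiv.Perm (Fin N)) := by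
    intro a ha hi
    by_cases hM : a + h ≤ M
    · have hinj : Set.InjOn f (Ico a (a + h)) := by
        intro x hx y hy hxy
        simp only [coe_Ico, Set.mem_Ico] at hx hy
        rcases lt_trichotomy x y with hlt | heq | hlt
        · exact absurd hxy (hf x y hlt (by omega) (by omega))
        · exact heq
        · exact absurd hxy.symm (hf y x hlt (by omega) (by omega))
      have := card_perm_min_mul_le ((Ico a (a + h)).image f) (c := f i)
        (mem_image_of_mem _ (by simp; omega))
      rw [card_image_of_injOn hinj, Nat.card_Ico, Nat.add_sub_cancel_left] at this
      refine le_trans (Nat.mul_le_mul_right _ (card_le_card ?_)) this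
      intro σ hσ
      simp only [mem_filter, mem_univ, true_and, mem_image, mem_Ico] at hσ ⊢
      rintro _ ⟨j, hj, rfl⟩
      exact hσ.2 j hj.1 hj.2
    · simp [hM]
  have hsub : ({σ : Equiv.Perm (Fin N) | IsMinimizer f σ M m i} : Finset _) ⊆
      ({σ : Equiv.Perm (Fin N) | i + h ≤ M ∧
        ∀ j, i ≤ j → j < i + h → σ (f i) ≤ σ (f j)} : Finset _) ∪
      ({σ : Equiv.Perm (Fin N) | i + 1 - h + h ≤ M ∧ ∀ j, i + 1 - h ≤ j → j < i + 1 - h + h →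
        σ (f i) ≤ σ (f j)} : Finset _) := by
    intro σ hσ
    simp only [mem_filter, mem_univ, true_and, mem_union] at hσ ⊢
    obtain ⟨a, ha, hi, hM, hmin⟩ := hσ
    by_cases hc : i + h ≤ a + m
    · exact Or.inl ⟨by omega, fun j hj hj' => hmin j (by omega) (by omega)⟩
    · exact Or.inr ⟨by omega, fun j hj hj' => hmin j (by omega) (by omega)⟩
  rcases Nat.eq_zero_or_pos m with rfl | hm
  · simp
  have hpos : 0 < h := by omega
  have h1 := aux i le_rfl (by omega)
  have h2 := aux (i + 1 - h) (by omega) (by omega)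
  have h3 := (card_le_card hsub).trans (card_union_le _ _)
  have h4 : m ≤ 2 * h := by omega
  nlinarith

open Classical in
/-- If positions at distance less than `m` have different classes, then some order of the classes
makes the window minimizers sparse. -/
theorem exists_perm_card_isMinimizer_mul_le {N : ℕ} (f : ℕ → Fin N) (M m : ℕ)
    (hf : ∀ i j, i < j → j < M → j < i + m → f i ≠ f j) :
    ∃ σ : Equiv.Perm (Fin N), #{i ∈ range M | IsMinimizer f σ M m i} * m ≤ 4 * M := by
  have h : ∑ σ : Equiv.Perm (Fin N), #{i ∈ range M | IsMinimizer f σ M m i} * m ≤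
      ∑ σ : Equiv.Perm (Fin N), 4 * M := by
    rw [← sum_mul]
    simp_rw [card_filter]
    rw [sum_comm, sum_mul]
    refine (sum_le_sum fun i _ =>
      (?_ : _ ≤ 4 * Fintype.card (Equiv.Perm (Fin N)))).trans_eq ?_
    · rw [← card_filter]; exact card_perm_isMinimizer_mul_le f M m hf i
    · simp only [sum_const, card_range, card_univ, smul_eq_mul]; ring
  obtain ⟨σ, -, hσ⟩ := exists_le_of_sum_le univ_nonempty h
  exact ⟨σ, hσ⟩

end IPM

/-! ### A static dictionary of linear size -/

namespace IPM

open Finset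

/-- Rows are placed greedily in order of decreasing size. A row `A` is barred from at most `#A * #J`
displacements by the items `J` already placed. If `#A ≥ 2`, each item of `J` shares its row with at
least `#A - 1 ≥ #A / 2` others, so the bound on pairs gives `#A * #J ≤ 2 * N`; smaller rows are
immediate. -/
theorem exists_displacement {ι : Type*} [DecidableEq ι] (I : Finset ι) (row b : ι → ℕ) (N : ℕ)
    (hN : #I ≤ N) (hpairs : #{p ∈ I.offDiag | row p.1 = row p.2} ≤ N)
    (hb : ∀ i ∈ I, ∀ j ∈ I, row i = row j → b i = b j → i = j) :
    ∃ disp : ℕ → ℕ, (∀ x, disp x ≤ 2 * N) ∧ Set.InjOn (fun i => disp (row i) + b i) I := by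
  suffices H : ∀ s : Finset ℕ, ∃ disp : ℕ → ℕ, (∀ x, disp x ≤ 2 * N) ∧
      Set.InjOn (fun i => disp (row i) + b i) {i | i ∈ I ∧ row i ∈ s} by
    obtain ⟨disp, h1, h2⟩ := H (I.image row)
    exact ⟨disp, h1, fun i hi j hj h => h2 ⟨hi, mem_image_of_mem _ hi⟩
      ⟨hj, mem_image_of_mem _ hj⟩ h⟩
  intro s
  induction s using Finset.induction_on_min_value (fun r => #{i ∈ I | row i = r}) with
  | empty => exact ⟨fun _ => 0, fun _ => Nat.zero_le _, by simp [Set.InjOn]⟩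
  | insert a s ha hmin ih =>
    obtain ⟨disp, hle, hinj⟩ := ih
    set A := {i ∈ I | row i = a} with hA
    set J := {i ∈ I | row i ∈ s} with hJ
    have hcard : #A * #J ≤ 2 * N := by
      rcases Nat.lt_or_ge #A 2 with h | h
      · have : #J ≤ #I := card_filter_le _ _
        nlinarith
      · have e : #{p ∈ I.offDiag | row p.1 = row p.2} =
            ∑ j ∈ I, #{p ∈ {p ∈ I.offDiag | row p.1 = row p.2} | p.1 = j} :=
          card_eq_sum_card_fiberwise fun p hp => by
            simp only [coe_filter, mem_offDiag, Set.mem_ofPred_eq] at hp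
            exact hp.1.1
        have e2 : ∀ j ∈ J, #A ≤ 2 * #{p ∈ {p ∈ I.offDiag | row p.1 = row p.2} | p.1 = j} := by
          intro j hj
          simp only [hJ, mem_filter] at hj
          have hmj := hmin (row j) hj.2
          have : #({i ∈ I | row i = row j}.erase j) ≤
              #{p ∈ {p ∈ I.offDiag | row p.1 = row p.2} | p.1 = j} := by
            refine card_le_card_of_injOn (fun i => (j, i)) ?_ ?_
            · intro i hi
              simp only [coe_erase, coe_filter, Set.mem_sdiff, Set.mem_ofPred_eq,
                Set.mem_singleton_iff] at hi
              simp [hi.1.1, hi.1.2, hj.1, Ne.symm hi.2]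
            · intro x _ y _ hxy
              exact (Prod.mk.inj hxy).2
          rw [card_erase_of_mem (by simp [hj.1])] at this
          change #A ≤ _ at hmj
          omega
        calc #A * #J = ∑ j ∈ J, #A := by rw [sum_const, smul_eq_mul, mul_comm]
          _ ≤ ∑ j ∈ J, 2 * #{p ∈ {p ∈ I.offDiag | row p.1 = row p.2} | p.1 = j} := sum_le_sum e2
          _ ≤ ∑ j ∈ I, 2 * #{p ∈ {p ∈ I.offDiag | row p.1 = row p.2} | p.1 = j} :=
            sum_le_sum_of_subset (filter_subset _ _)
          _ = 2 * #{p ∈ I.offDiag | row p.1 = row p.2} := by rw [e, mul_sum]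
          _ ≤ 2 * N := Nat.mul_le_mul_left _ hpairs
    obtain ⟨d, hd, hd'⟩ : ∃ d ∈ range (2 * N + 1),
        d ∉ (A ×ˢ J).image (fun p => disp (row p.2) + b p.2 - b p.1) := by
      by_contra! hcon
      have := (card_le_card hcon).trans card_image_le
      rw [card_product, card_range] at this
      omega
    have hd2 : ∀ i ∈ A, ∀ j ∈ J, d + b i ≠ disp (row j) + b j := by
      intro i hi j hj heq
      exact hd' (mem_image.2 ⟨(i, j), mem_product.2 ⟨hi, hj⟩, by
        change disp (row j) + b j - b i = d
        omega⟩)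
    refine ⟨Function.update disp a d, fun x => ?_, ?_⟩
    · by_cases hx : x = a
      · subst hx; simp only [Function.update_self]; simp only [mem_range] at hd; omega
      · rw [Function.update_of_ne hx]; exact hle x
    · rintro i ⟨hi, hi'⟩ j ⟨hj, hj'⟩ hij
      have hmem : ∀ k ∈ I, row k ∈ insert a s → row k ≠ a → k ∈ J := fun k hk hk' hne => by
        rcases mem_insert.1 hk' with h | h
        · exact absurd h hne
        · exact mem_filter.2 ⟨hk, h⟩
      by_cases h1 : row i = a <;> by_cases h2 : row j = a
      · refine hb i hi j hj (h1.trans h2.symm) ?_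
        simpa [h1, h2] using hij
      · simp only [h1, Function.update_self, Function.update_of_ne h2] at hij
        exact absurd hij (hd2 i (mem_filter.2 ⟨hi, h1⟩) j (hmem j hj hj' h2))
      · simp only [h2, Function.update_self, Function.update_of_ne h1] at hij
        exact absurd hij.symm (hd2 j (mem_filter.2 ⟨hj, h2⟩) i (hmem i hi hi' h1))
      · simp only [Function.update_of_ne h1, Function.update_of_ne h2] at hij
        exact hinj (mem_filter.1 (hmem i hi hi' h1)) (mem_filter.1 (hmem j hj hj' h2)) hij

theorem eq_of_add_mod_eq {U x y z : ℕ} (hx : x < U) (hy : y < U)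
    (h : (x + z) % U = (y + z) % U) : x = y := by
  have : x ≡ y [MOD U] := Nat.ModEq.add_right_cancel' z h
  exact this.eq_of_lt_of_lt hx hy

/-- A collision determines `B i` from the other values of `B`, so overwriting `B i` by an arbitrary
value loses no information. -/
theorem card_shift_collision_mul_le {U : ℕ} (x y : ℕ) {i j : Fin U} (hij : i ≠ j) :
    #{B : Fin U → Fin U | (x + B i) % U = (y + B j) % U} * U ≤ Fintype.card (Fin U → Fin U) := by
  suffices H : #{B : Fin U → Fin U | (x + B i) % U = (y + B j) % U} * #(univ : Finset (Fin U)) ≤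
      Fintype.card (Fin U → Fin U) by simpa only [card_univ, Fintype.card_fin] using H
  rw [← card_product, ← card_univ]
  refine card_le_card_of_injOn (fun p => Function.update p.1 i p.2) (fun _ _ => mem_univ _) ?_
  rintro ⟨B, a⟩ h1 ⟨B', a'⟩ h2 h
  simp only [coe_product, Set.mem_prod, mem_coe, mem_filter, mem_univ, true_and, and_true] at h1 h2
  simp only at h
  have ha : a = a' := by simpa using congrFun h i
  have hne : ∀ k, k ≠ i → B k = B' k := fun k hk => by
    simpa [Function.update_of_ne hk] using congrFun h k
  have hi : B i = B' i := by
    rw [hne j hij.symm, ← h2] at h1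
    rw [Nat.add_comm x, Nat.add_comm x] at h1
    exact Fin.ext (eq_of_add_mod_eq (B i).2 (B' i).2 h1)
  rw [ha, Prod.mk.injEq]
  refine ⟨funext fun k => ?_, rfl⟩
  by_cases hk : k = i
  · rw [hk, hi]
  · exact hne k hk

/-- For random shifts, pairs with equal `b` never collide, since their `c` differ, and the others
collide with probability at most `1 / U`. There are at most `U * U` pairs, so some choice does no
worse than the average `U`. -/
theorem exists_shift {ι : Type*} [DecidableEq ι] (I : Finset ι) (c b : ι → ℕ) (U : ℕ)
    (hU : #I ≤ U) (hpos : 0 < U) (hc : ∀ i ∈ I, c i < U) (hb : ∀ i ∈ I, b i < U)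
    (hinj : Set.InjOn (fun i => (c i, b i)) I) :
    ∃ B : ℕ → ℕ, (∀ x, B x < U) ∧
      #{p ∈ I.offDiag | (c p.1 + B (b p.1)) % U = (c p.2 + B (b p.2)) % U} ≤ U := by
  let ext : (Fin U → Fin U) → ℕ → ℕ := fun B x => if h : x < U then B ⟨x, h⟩ else 0
  have hext : ∀ B x, ext B x < U := fun B x => by
    simp only [ext]; split_ifs
    · exact Fin.is_lt _
    · exact hpos
  have key : ∀ p ∈ I.offDiag, #{B : Fin U → Fin U |
      (c p.1 + ext B (b p.1)) % U = (c p.2 + ext B (b p.2)) % U} * U ≤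
      Fintype.card (Fin U → Fin U) := by
    rintro ⟨i, j⟩ hp
    obtain ⟨hi, hj, hij⟩ := mem_offDiag.1 hp
    by_cases hbb : b i = b j
    · rw [filter_eq_empty_iff.2]
      · simp
      · intro B _ h
        rw [hbb] at h
        exact hij (hinj hi hj (Prod.ext (eq_of_add_mod_eq (hc i hi) (hc j hj) h) hbb))
    · have := card_shift_collision_mul_le (c i) (c j) (i := ⟨b i, hb i hi⟩) (j := ⟨b j, hb j hj⟩)
        (by simpa using hbb)
      simpa only [ext, hb i hi, hb j hj, dite_true] using this
  have hsum : ∑ B : Fin U → Fin U, #{p ∈ I.offDiag |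
      (c p.1 + ext B (b p.1)) % U = (c p.2 + ext B (b p.2)) % U} * U ≤
      ∑ B : Fin U → Fin U, U * U := by
    rw [← sum_mul]
    simp_rw [card_filter]
    rw [sum_comm, sum_mul]
    refine (sum_le_sum fun p hp => (?_ : _ ≤ Fintype.card (Fin U → Fin U))).trans ?_
    · rw [← card_filter]; exact key p hp
    · rw [sum_const, sum_const, card_univ, smul_eq_mul, smul_eq_mul, mul_comm]
      refine Nat.mul_le_mul_left _ ?_
      rw [offDiag_card]
      exact (Nat.sub_le _ _).trans (Nat.mul_le_mul hU hU)
  have : Nonempty (Fin U → Fin U) := ⟨id⟩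
  obtain ⟨B, -, hB⟩ := exists_le_of_sum_le univ_nonempty hsum
  exact ⟨ext B, hext B, Nat.le_of_mul_le_mul_right hB hpos⟩

/-- A static dictionary for pairs `(c i, b i)`: three tables of linear size determine `val i`. -/
theorem exists_dictionary {ι : Type*} [DecidableEq ι] (I : Finset ι) (c b val : ι → ℕ) (U : ℕ)
    (hU : #I ≤ U) (hpos : 0 < U) (hc : ∀ i ∈ I, c i < U) (hb : ∀ i ∈ I, b i < U)
    (hinj : Set.InjOn (fun i => (c i, b i)) I) :
    ∃ B disp tab : ℕ → ℕ, (∀ x, B x < U) ∧ (∀ x, disp x ≤ 2 * U) ∧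
      (∀ x, tab x = 0 ∨ ∃ i ∈ I, tab x = val i) ∧
      ∀ i ∈ I, tab (disp ((c i + B (b i)) % U) + b i) = val i := by
  classical
  obtain ⟨B, hB, hp⟩ := exists_shift I c b U hU hpos hc hb hinj
  obtain ⟨disp, hd, hdi⟩ := exists_displacement I (fun i => (c i + B (b i)) % U) b U hU hp (by
    intro i hi j hj hr hbb
    simp only [hbb] at hr
    exact hinj hi hj (Prod.ext (eq_of_add_mod_eq (hc i hi) (hc j hj) hr) hbb))
  -- The address is injective on `I`, so `tab` inverts it; unused cells hold 0.
  refine ⟨B, disp, fun x => if h : ∃ i ∈ I, disp ((c i + B (b i)) % U) + b i = x then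
    val h.choose else 0, hB, hd, fun x => ?_, fun i hi => ?_⟩
  · dsimp only
    split_ifs with h
    · exact Or.inr ⟨_, h.choose_spec.1, rfl⟩
    · exact Or.inl rfl
  · have h : ∃ j ∈ I, disp ((c j + B (b j)) % U) + b j = disp ((c i + B (b i)) % U) + b i :=
      ⟨i, hi, rfl⟩
    simp only [h, dite_true]
    rw [hdi h.choose_spec.1 hi h.choose_spec.2]

end IPM

/-! ### Deterministic fingerprints of fragments -/

namespace IPM

open Finset Polynomial

/-- The polynomial whose coefficients are the letters of the word, in reverse order. -/
noncomputable def wordPoly {α K : Type*} [Field K] (e : α → K) : List α → K[X]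
  | [] => 0
  | x :: u => C (e x) * X ^ u.length + wordPoly e u

section
variable {α K : Type*} [Field K] (e : α → K)

theorem wordPoly_append (u w : List α) :
    wordPoly e (u ++ w) = wordPoly e u * X ^ w.length + wordPoly e w := by
  induction u with
  | nil => simp [wordPoly]
  | cons x u ih => simp only [List.cons_append, wordPoly, ih, List.length_append]; ring

theorem degree_wordPoly_lt (u : List α) : (wordPoly e u).degree < u.length := by
  induction u with
  | nil => simp [wordPoly]
  | cons x u ih =>
    rw [wordPoly]
    refine (degree_add_le _ _).trans_lt (max_lt ?_ (ih.trans ?_))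
    · refine (degree_C_mul_X_pow_le _ _).trans_lt ?_
      simp only [List.length_cons]
      exact_mod_cast Nat.lt_succ_self _
    · simp only [List.length_cons]
      exact_mod_cast Nat.lt_succ_self _

theorem natDegree_wordPoly_le (u : List α) : (wordPoly e u).natDegree ≤ u.length :=
  natDegree_le_iff_degree_le.2 (degree_wordPoly_lt e u).le

theorem wordPoly_injOn {s : Set α} (he : Set.InjOn e s) :
    ∀ {u w : List α}, u.length = w.length → (∀ x ∈ u, x ∈ s) → (∀ x ∈ w, x ∈ s) →
      wordPoly e u = wordPoly e w → u = w
  | [], [], _, _, _, _ => rfl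
  | x :: u, y :: w, hl, hu, hw, h => by
    have hl' : u.length = w.length := by simpa using hl
    have hc : ∀ (z : α) (t : List α), (wordPoly e (z :: t)).coeff t.length = e z := fun z t => by
      simp [wordPoly, coeff_eq_zero_of_degree_lt (degree_wordPoly_lt e t)]
    have hx : e x = e y := by rw [← hc x u, ← hc y w, h, hl']
    have hxy : x = y := he (hu x (by simp)) (hw y (by simp)) hx
    subst hxy
    simp only [wordPoly, hl', add_right_inj] at h
    rw [wordPoly_injOn he hl' (fun z hz => hu z (by simp [hz])) (fun z hz => hw z (by simp [hz])) h]

/-- Over a large field some evaluation point separates all fragments of a word. -/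
theorem exists_eval_wordPoly_injOn (v : List α) [Finite K]
    (he : Set.InjOn e {x | x ∈ v}) (hK : (v.length + 1) ^ 4 ≤ Nat.card K) :
    ∃ β : K, ∀ a b L, a + L ≤ v.length → b + L ≤ v.length →
      (wordPoly e ((v.drop a).take L)).eval β = (wordPoly e ((v.drop b).take L)).eval β →
      (v.drop a).take L = (v.drop b).take L := by
  classical
  set n := v.length
  let W : ℕ × ℕ × ℕ → K[X] := fun t =>
    wordPoly e ((v.drop t.1).take t.2.2) - wordPoly e ((v.drop t.2.1).take t.2.2)
  let I := ((range (n + 1)) ×ˢ (range (n + 1)) ×ˢ (range (n + 1))).filter fun t => W t ≠ 0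
  have hlen : ∀ a L, ((v.drop a).take L).length ≤ n := fun a L => by simp [n]
  -- At most `(n + 1) ^ 3` nonzero differences of degree at most `n`: their product has fewer roots
  -- than `K` has elements, and any non-root separates all fragments.
  have hdeg : (∏ t ∈ I, W t).natDegree < Nat.card K := by
    calc (∏ t ∈ I, W t).natDegree ≤ ∑ t ∈ I, (W t).natDegree := natDegree_prod_le _ _
      _ ≤ ∑ t ∈ I, n := sum_le_sum fun t _ => (natDegree_sub_le _ _).trans
          (max_le ((natDegree_wordPoly_le e _).trans (hlen _ _))
            ((natDegree_wordPoly_le e _).trans (hlen _ _)))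
      _ = #I * n := by simp
      _ ≤ (n + 1) ^ 3 * n := Nat.mul_le_mul_right _ ((card_filter_le _ _).trans_eq (by
          simp only [card_product, card_range]; ring))
      _ < (n + 1) ^ 4 := by 
          rw [pow_succ _ 3]; exact Nat.mul_lt_mul_of_pos_left (by omega) (by positivity)
      _ ≤ Nat.card K := hK
  have hne : (∏ t ∈ I, W t) ≠ 0 := prod_ne_zero_iff.2 fun t ht => (mem_filter.1 ht).2
  obtain ⟨β, hβ⟩ : ∃ β, (∏ t ∈ I, W t).eval β ≠ 0 := by
    by_contra! hcon
    have := Fintype.ofFinite K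
    refine hne (eq_zero_of_natDegree_lt_card_of_eval_eq_zero' _ univ (fun x _ => hcon x) ?_)
    rwa [card_univ, ← Nat.card_eq_fintype_card]
  rw [eval_prod, prod_ne_zero_iff] at hβ
  refine ⟨β, fun a b L ha hb h => ?_⟩
  have hW : W (a, b, L) = 0 := by
    by_contra hW
    refine hβ (a, b, L) (mem_filter.2 ⟨?_, hW⟩) ?_
    · simp only [mem_product, mem_range]; omega
    · simp [W, h]
  refine wordPoly_injOn e he ?_ ?_ ?_ (sub_eq_zero.1 hW)
  · simp only [List.length_take, List.length_drop]; omega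
  · exact fun x hx => List.mem_of_mem_drop (List.mem_of_mem_take hx)
  · exact fun x hx => List.mem_of_mem_drop (List.mem_of_mem_take hx)

theorem exists_injOn_letters (v : List α) [Finite K] (hK : v.length ≤ Nat.card K) :
    ∃ e : α → K, Set.InjOn e {x | x ∈ v} := by
  classical
  have := Fintype.ofFinite K
  have h : Fintype.card {x // x ∈ v.toFinset} ≤ Fintype.card K := by
    rw [Fintype.card_coe, ← Nat.card_eq_fintype_card]
    exact (List.toFinset_card_le v).trans hK
  obtain ⟨φ⟩ := Function.Embedding.nonempty_of_card_le h
  refine ⟨fun x => if h : x ∈ v.toFinset then φ ⟨x, h⟩ else 0, fun x hx y hy hxy => ?_⟩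
  have hx' : x ∈ v.toFinset := List.mem_toFinset.2 hx
  have hy' : y ∈ v.toFinset := List.mem_toFinset.2 hy
  simp only [hx', hy', dite_true] at hxy
  exact congrArg Subtype.val (φ.injective hxy)

end

/-- Multiplication by `z` is linear, so storing its matrix for `z = β ^ L` reduces products in `K`
to arithmetic in the prime field. -/
theorem repr_mul_eq_sum {F K ι : Type*} [Field F] [Field K] [Algebra F K] [Fintype ι]
    (B : Module.Basis ι F K) (y z : K) (t : ι) :
    B.repr (y * z) t = ∑ i, B.repr y i * B.repr (B i * z) t := by
  conv_lhs => rw [← B.sum_repr y, sum_mul]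
  simp [Finsupp.finsetSum_apply]

/-- Bertrand's postulate at `⌊√n⌋ + 1`. The lower bound makes `p ^ 8 ≥ (n + 1) ^ 4`; the upper bound
lets products of residues fit into a word. -/
theorem exists_prime_sq_le (n : ℕ) : ∃ p : ℕ, p.Prime ∧ n + 1 ≤ p ^ 2 ∧ p ^ 2 ≤ 16 * (n + 1) := by
  obtain ⟨p, hp, h1, h2⟩ := Nat.exists_prime_lt_and_le_two_mul (Nat.sqrt n + 1) (by omega)
  have h3 := Nat.sqrt_le' n
  have h4 := Nat.lt_succ_sqrt' n
  refine ⟨p, hp, ?_, ?_⟩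
  · exact (Nat.succ_le_of_lt h4).trans (Nat.pow_le_pow_left h1.le 2)
  · have := Nat.pow_le_pow_left h2 2
    nlinarith [sq_nonneg ((Nat.sqrt n : ℤ) - 1), Nat.zero_le (Nat.sqrt n)]

/-- Equality of fragments of a word can be tested by arithmetic modulo a prime of the order of
the square root of the length, on tables of linear size. -/
theorem exists_fingerprint {α : Type*} (v : List α) :
    ∃ (p : ℕ) (H : Fin 8 → ℕ → ℕ) (M : Fin 8 → Fin 8 → ℕ → ℕ),
      0 < p ∧ p ^ 2 ≤ 16 * (v.length + 1) ∧ (∀ t i, H t i < p) ∧ (∀ i t L, M i t L < p) ∧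
      ∀ a b L, a + L ≤ v.length → b + L ≤ v.length →
        ((v.drop a).take L = (v.drop b).take L ↔
          ∀ t, (H t (a + L) + ∑ i, H i b * M i t L) % p =
            (H t (b + L) + ∑ i, H i a * M i t L) % p) := by
  obtain ⟨p, hp, hp1, hp2⟩ := exists_prime_sq_le v.length
  have := Fact.mk hp
  let K := GaloisField p 8
  have hcard : Nat.card K = p ^ 8 := GaloisField.card p 8 (by norm_num)
  have hK : (v.length + 1) ^ 4 ≤ Nat.card K := by
    rw [hcard, show 8 = 2 * 4 by norm_num, pow_mul]
    exact Nat.pow_le_pow_left hp1 4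
  have : Finite K := Nat.finite_of_card_ne_zero (by rw [hcard]; exact (pow_pos hp.pos 8).ne')
  obtain ⟨e, he⟩ := exists_injOn_letters (K := K) v
    (le_trans (by nlinarith [Nat.le_self_pow (n := 4) (by norm_num) (v.length + 1)]) hK)
  obtain ⟨β, hβ⟩ := exists_eval_wordPoly_injOn e v he hK
  let B : Module.Basis (Fin 8) (ZMod p) K :=
    Module.finBasisOfFinrankEq (ZMod p) K (GaloisField.finrank p (by norm_num))
  let h : List α → K := fun u => (wordPoly e u).eval β
  have hsplit : ∀ a L, a + L ≤ v.length →
      h (v.take (a + L)) = h (v.take a) * β ^ L + h ((v.drop a).take L) := fun a L ha => by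
    have : v.take (a + L) = v.take a ++ (v.drop a).take L := List.take_add
    simp only [h, this, wordPoly_append, eval_add, eval_mul, eval_pow, eval_X]
    congr 3
    simp only [List.length_take, List.length_drop]; omega
  refine ⟨p, fun t i => (B.repr (h (v.take i)) t).val,
    fun i t L => (B.repr (B i * β ^ L) t).val, hp.pos, hp2, fun _ _ => ZMod.val_lt _,
    fun _ _ _ => ZMod.val_lt _, fun a b L ha hb => ?_⟩
  -- The fragment at `a` has value `h (take (a + L)) - h (take a) * β ^ L`. Moving the subtracted
  -- terms across the equation leaves only additions, whence the crossed `a` and `b`.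
  have hcoord : ∀ a b t,
      (((B.repr (h (v.take (a + L))) t).val + ∑ i, (B.repr (h (v.take b)) i).val *
        (B.repr (B i * β ^ L) t).val : ℕ) : ZMod p) =
      B.repr (h (v.take (a + L)) + h (v.take b) * β ^ L) t := fun a b t => by
    rw [map_add, Finsupp.add_apply, repr_mul_eq_sum]
    push_cast
    simp only [ZMod.natCast_zmod_val]
  simp_rw [← ZMod.natCast_eq_natCast_iff', hcoord, ← DFunLike.ext_iff, EmbeddingLike.apply_eq_iff_eq]
  rw [hsplit a L ha, hsplit b L hb]
  constructor
  · intro heq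
    rw [heq]; ring
  · intro heq
    refine hβ a b L ha hb ?_
    change h _ = h _
    linear_combination heq

end IPM

/-! ### Sampling a square-free word and indexing the samples -/

namespace IPM

open Finset

section
variable {α : Type*} {v : List α}

theorem take_drop_eq_of_take_drop_eq {i j L : ℕ}
    (h : (v.drop i).take L = (v.drop j).take L) {a b : ℕ} (hab : a + b ≤ L) :
    (v.drop (i + a)).take b = (v.drop (j + a)).take b := by
  have key : ∀ i, (v.drop (i + a)).take b = (((v.drop i).take L).drop a).take b := fun i => by
    rw [List.drop_take, List.take_take, List.drop_drop, min_eq_left (by omega)]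
  rw [key, key, h]

/-- In a square-free word the occurrences of a word are further apart than its length. -/
theorem SquareFree.add_lt_of_take_drop_eq (hv : SquareFree v) {i j L : ℕ} (hij : i < j)
    (hj : j + L ≤ v.length) (h : (v.drop i).take L = (v.drop j).take L) : i + L < j := by
  by_contra! hcon
  obtain ⟨d, rfl⟩ := Nat.exists_eq_add_of_lt hij
  have h1 : (v.drop i).take (d + 1) = (v.drop (i + (d + 1))).take (d + 1) :=
    take_drop_eq_of_take_drop_eq (a := 0) h (by omega)
  refine hv ((v.drop i).take (d + 1)) ?_ ⟨v.take i, v.drop (i + (d + 1) + (d + 1)), ?_⟩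
  · intro h0
    have := congrArg List.length h0
    simp only [List.length_take, List.length_drop, List.length_nil] at this
    omega
  · rw [List.append_assoc, List.append_assoc]
    nth_rw 2 [h1]
    have key : ∀ a b, (v.drop a).take b ++ v.drop (a + b) = v.drop a := fun a b => by
      rw [← List.drop_drop, List.take_append_drop]
    rw [key, key, List.take_append_drop]

theorem SquareFree.eq_of_take_drop_eq (hv : SquareFree v) {i j L : ℕ} (hi : i + L ≤ v.length)
    (hj : j + L ≤ v.length) (h : (v.drop i).take L = (v.drop j).take L) (hij : i ≤ j + L)
    (hji : j ≤ i + L) : i = j := by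
  rcases lt_trichotomy i j with hlt | heq | hlt
  · have := hv.add_lt_of_take_drop_eq hlt hj h; omega
  · exact heq
  · have := hv.add_lt_of_take_drop_eq hlt hi h.symm; omega

/-- The least index with the same value names the class. This turns fragments over an arbitrary
alphabet into elements of `Fin n`, whose permutations can be counted. -/
theorem exists_class_index {β : Type*} (g : ℕ → β) {n : ℕ} (hn : 0 < n) :
    ∃ f : ℕ → Fin n, ∀ i < n, ∀ j < n, (f i = f j ↔ g i = g j) := by
  classical
  have hex : ∀ i, ∃ j, g j = g i := fun i => ⟨i, rfl⟩
  refine ⟨fun i => if h : i < n then ⟨Nat.find (hex i), (Nat.find_min' (hex i) rfl).trans_lt h⟩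
      else ⟨0, hn⟩,
    fun i hi j hj => ?_⟩
  simp only [hi, hj, dite_true, Fin.mk.injEq]
  constructor
  · intro h
    rw [← Nat.find_spec (hex i), h, Nat.find_spec (hex j)]
  · intro h
    simp only [h]

/-- A sparse set of positions, containing one position of each window of length `m`, chosen
according to the fragment of length `2 m - 1` that starts with the window. -/
theorem SquareFree.exists_sampling (hv : SquareFree v) {m : ℕ} (hm : 0 < m) :
    ∃ (S : Finset ℕ) (ρ : ℕ → ℕ), #S * m ≤ 4 * v.length ∧ (∀ s ∈ S, s + m ≤ v.length) ∧
      ∀ a, a + 2 * m ≤ v.length + 1 → a ≤ ρ a ∧ ρ a < a + m ∧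
        ∀ b, b + 2 * m ≤ v.length + 1 →
          (v.drop a).take (2 * m - 1) = (v.drop b).take (2 * m - 1) → b + (ρ a - a) ∈ S := by
  classical
  rcases Nat.eq_zero_or_pos v.length with hn | hn
  · refine ⟨∅, id, by simp, by simp, fun a ha => by omega⟩
  obtain ⟨f, hf⟩ := exists_class_index (fun i => (v.drop i).take m) hn
  set M := v.length + 1 - m with hM
  obtain ⟨σ, hσ⟩ := exists_perm_card_isMinimizer_mul_le f M m (fun i j hij hj hjm h => by
    have := hv.add_lt_of_take_drop_eq hij (by omega) ((hf i (by omega) j (by omega)).1 h)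
    omega)
  have hmin : ∀ a, ∃ s ∈ Ico a (a + m), ∀ j ∈ Ico a (a + m), σ (f s) ≤ σ (f j) := fun a =>
    exists_min_image _ _ ⟨a, by simp [hm]⟩
  choose ρ hρ hρmin using hmin
  simp only [mem_Ico] at hρ hρmin
  refine ⟨{i ∈ range M | IsMinimizer f σ M m i}, ρ, hσ.trans (by omega), fun s hs => ?_,
    fun a ha => ⟨(hρ a).1, (hρ a).2, fun b hb hab => ?_⟩⟩
  · have := mem_range.1 (mem_filter.1 hs).1
    omega
  · have h1 := hρ a
    refine mem_filter.2 ⟨mem_range.2 (by omega), b, by omega, by omega, by omega, fun j hj hj' => ?_⟩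
    -- The `m` fragments of length `m` starting in a window lie within `2 m - 1` letters, so both
    -- windows show the same classes and the least position of one is least in the other.
    have key : ∀ t < m, f (b + t) = f (a + t) := fun t ht =>
      (hf _ (by omega) _ (by omega)).2 (take_drop_eq_of_take_drop_eq hab.symm (by omega))
    have h2 := hρmin a (a + (j - b)) ⟨by omega, by omega⟩
    rwa [← key (j - b) (by omega), show b + (j - b) = j by omega,
      show ρ a = a + (ρ a - a) by omega, ← key (ρ a - a) (by omega)] at h2

theorem exists_code {β : Type*} (Λ : Finset β) {U : ℕ} (hU : #Λ ≤ U) (hpos : 0 < U) :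
    ∃ e : β → ℕ, (∀ x, e x < U) ∧ Set.InjOn e Λ := by
  classical
  refine ⟨fun x => if h : x ∈ Λ then Λ.equivFin ⟨x, h⟩ else 0, fun x => ?_, fun x hx y hy h => ?_⟩
  · dsimp only
    split_ifs
    · exact (Fin.is_lt _).trans_le hU
    · exact hpos
  · have hx' : x ∈ Λ := hx
    have hy' : y ∈ Λ := hy
    simp only [hx', hy', dite_true] at h
    exact congrArg Subtype.val (Λ.equivFin.injective (Fin.ext h))

/-- The tables that locate, for a fragment of length `L` at position `l`, the occurrences by means
of a sample position inside the fragment. The level of the fragment is the power of two `lev L`;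
the block `g` of level `m` has the number `N / m + g`. -/
theorem SquareFree.exists_index (hv : SquareFree v) (hn : 0 < v.length) :
    ∃ (N : ℕ) (lev rep cls B disp tab : ℕ → ℕ), N ≤ 2 * v.length ∧
      (∀ L, 0 < L → 0 < lev L ∧ 3 * lev L ≤ L + 2 ∧ L ≤ 6 * lev L) ∧
      (∀ x, cls x < 8 * v.length) ∧ (∀ x, B x < 8 * v.length) ∧
      (∀ x, disp x ≤ 2 * (8 * v.length)) ∧ (∀ x, tab x ≤ v.length) ∧
      ∀ l L, 0 < L → l + L ≤ v.length →
        let m := lev L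
        let h := N / m + (l + m - 1) / m
        l ≤ rep h ∧ rep h < l + L ∧
        ∀ q, q + L ≤ v.length → (v.drop l).take L = (v.drop q).take L →
          let s := q + (rep h - l)
          tab (disp ((cls h + B (N / m + s / m)) % (8 * v.length)) + (N / m + s / m)) = s := by
  classical
  set n := v.length with hndef
  choose S ρ hcard hS hρ using fun k : ℕ => hv.exists_sampling (Nat.two_pow_pos k)
  let K := Nat.log 2 n + 1
  have hN1 : n < 2 ^ K := Nat.lt_pow_succ_log_self (by norm_num) n
  have hN2 : 2 ^ K ≤ 2 * n := by
    have := Nat.pow_log_le_self 2 hn.ne'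
    simp only [K, pow_succ]; omega
  let I : Finset (Σ _ : ℕ, ℕ) := (range K).sigma S
  have hI : #I ≤ 8 * n := by
    rw [card_sigma]
    calc ∑ k ∈ range K, #(S k) ≤ ∑ k ∈ range K, (4 * n) / 2 ^ k :=
          sum_le_sum fun k _ => (Nat.le_div_iff_mul_le (Nat.two_pow_pos k)).2 (hcard k)
      _ ≤ (4 * n) * 2 / (2 - 1) := Nat.geom_sum_le le_rfl _ _
      _ = 8 * n := by omega
  let label : ℕ → ℕ → ℕ × List α := fun k s => (k, (v.drop s).take (2 ^ k))
  obtain ⟨e, he, hinj⟩ := exists_code (I.image fun i => label i.1 i.2)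
    (card_image_le.trans hI) (by omega)
  obtain ⟨B, disp, tab, hB, hd, ht, htab⟩ := exists_dictionary I (fun i => e (label i.1 i.2))
    (fun i => 2 ^ K / 2 ^ i.1 + i.2 / 2 ^ i.1) (fun i => i.2) (8 * n) hI (by omega)
    (fun i _ => he _)
    (fun i hi => by
      have h1 := hS _ _ (mem_sigma.1 hi).2
      have h2 : 2 ^ K / 2 ^ i.1 ≤ 2 ^ K := Nat.div_le_self _ _
      have h3 : i.2 / 2 ^ i.1 ≤ i.2 := Nat.div_le_self _ _
      have h4 := Nat.two_pow_pos i.1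
      omega)
    -- Keys are distinct: the class fixes the level and the fragment, and two positions in one block
    -- are less than `2 ^ k` apart, so equal fragments there coincide by square-freeness.
    (by
      rintro ⟨k, s⟩ hi ⟨k', s'⟩ hj h
      simp only [Prod.mk.injEq] at h
      have h1 := hinj (mem_image_of_mem _ hi) (mem_image_of_mem _ hj) h.1
      simp only [label, Prod.mk.injEq] at h1
      obtain ⟨rfl, h1⟩ := h1
      have h2 : s / 2 ^ k = s' / 2 ^ k := by simpa using h.2
      have h3 : s < s' + 2 ^ k := by
        have := Nat.lt_div_mul_add (a := s) (Nat.two_pow_pos k)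
        have := Nat.div_mul_le_self s' (2 ^ k)
        rw [h2] at *; omega
      have h4 : s' < s + 2 ^ k := by
        have := Nat.lt_div_mul_add (a := s') (Nat.two_pow_pos k)
        have := Nat.div_mul_le_self s (2 ^ k)
        rw [h2] at *; omega
      have h5 : s = s' := hv.eq_of_take_drop_eq (hS _ _ (mem_sigma.1 hi).2)
        (hS _ _ (mem_sigma.1 hj).2) h1
        h3.le h4.le
      rw [h5])
  -- Blocks are numbered as in a binary heap: those of level `2 ^ k` occupy `[2 ^ (K - k), 2 ^ (K -
  -- k + 1))`, so the logarithm of a number reveals its level and one linear table serves all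
  -- levels.
  let lv : ℕ → ℕ := fun x => K - Nat.log 2 x
  let rep : ℕ → ℕ := fun x => ρ (lv x) ((x - 2 ^ K / 2 ^ lv x) * 2 ^ lv x)
  -- `L ≥ 3 m - 2` leaves room for up to `m - 1` letters before the first multiple of `m` and for
  -- the `2 m - 1` letters that determine the sample.
  refine ⟨2 ^ K, fun L => 2 ^ Nat.log 2 ((L + 2) / 3), rep,
    fun x => e (label (lv x) (rep x)), B, disp, tab, hN2, fun L hL => ?_, fun x => he _, hB, hd,
    fun x => ?_, fun l L hL hl => ?_⟩
  · have h1 := Nat.pow_log_le_self 2 (x := (L + 2) / 3) (by omega)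
    have h2 := Nat.lt_pow_succ_log_self (b := 2) (by norm_num) ((L + 2) / 3)
    rw [pow_succ] at h2
    have := Nat.two_pow_pos (Nat.log 2 ((L + 2) / 3))
    dsimp only
    omega
  · rcases ht x with h | ⟨i, hi, h⟩
    · omega
    · rw [h]
      exact (Nat.le_add_right _ _).trans (hS _ _ (mem_sigma.1 hi).2)
  · set k := Nat.log 2 ((L + 2) / 3) with hk
    have hm3 := Nat.pow_log_le_self 2 (x := (L + 2) / 3) (by omega)
    rw [← hk] at hm3
    have hmpos := Nat.two_pow_pos k
    have hkK : k < K := Nat.lt_succ_of_le (Nat.log_mono_right (by omega))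
    set m := 2 ^ k with hm
    have hNm : 2 ^ K / m = 2 ^ (K - k) := Nat.pow_div hkK.le (by norm_num)
    have hNm' : 2 ^ (K - k) * m = 2 ^ K := by rw [hm, ← pow_add]; congr 1; omega
    set g := (l + m - 1) / m with hg
    have hg1 : g * m ≤ l + m - 1 := Nat.div_mul_le_self _ _
    have hg2 : l + m - 1 < g * m + m := Nat.lt_div_mul_add hmpos
    clear_value g
    have hg3 : g < 2 ^ (K - k) := by
      by_contra! hcon
      have := Nat.mul_le_mul_right m hcon
      omega
    have hlog : Nat.log 2 (2 ^ K / m + g) = K - k := by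
      rw [hNm]
      refine Nat.log_eq_of_pow_le_of_lt_pow (by omega) ?_
      rw [pow_succ]; omega
    have hlv : lv (2 ^ K / m + g) = k := by
      simp only [lv, hlog]; omega
    have hrep : rep (2 ^ K / m + g) = ρ k (g * m) := by
      simp only [rep, hlv, ← hm, Nat.add_sub_cancel_left]
    obtain ⟨hs1, hs2, hs3⟩ := hρ k (g * m) (by omega)
    dsimp only
    rw [← hk, ← hm, ← hg, hrep, hlv]
    set s := ρ k (g * m) with hs
    rw [← hm] at hs2 hs3
    refine ⟨by omega, by omega, fun q hq hlq => ?_⟩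
    have hmem : (⟨k, q + (s - l)⟩ : Σ _ : ℕ, ℕ) ∈ I := by
      refine mem_sigma.2 ⟨mem_range.2 hkK, ?_⟩
      have h1 : (v.drop (g * m)).take (2 * m - 1) =
          (v.drop (q + (g * m - l))).take (2 * m - 1) := by
        have := take_drop_eq_of_take_drop_eq hlq (a := g * m - l) (b := 2 * m - 1) (by omega)
        rwa [show l + (g * m - l) = g * m by omega] at this
      have h2 := hs3 (q + (g * m - l)) (by omega) h1
      rwa [show q + (g * m - l) + (s - g * m) = q + (s - l) by omega] at h2
    have hlab : label k s = label k (q + (s - l)) := by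
      have := take_drop_eq_of_take_drop_eq hlq (a := s - l) (b := m) (by omega)
      rw [show l + (s - l) = s by omega] at this
      simp only [label, ← hm, this]
    have := htab _ hmem
    rw [hlab]
    exact this

end

end IPM

/-! ### Evaluating expressions without overflow -/

namespace WordRAM.Expr

section
variable {w : ℕ} {mem args : ℕ → ℕ} {a b : Expr} {x y : ℕ}

theorem eval_const {k : ℕ} (h : k < 2 ^ w) : (const k).eval w mem args = k := Nat.mod_eq_of_lt h

theorem eval_arg {i : Fin 4} (hx : args i = x) (h : x < 2 ^ w) : (arg i).eval w mem args = x := by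
  rw [eval, hx, Nat.mod_eq_of_lt h]

theorem eval_add (ha : a.eval w mem args = x) (hb : b.eval w mem args = y) (h : x + y < 2 ^ w) :
    (op .add a b).eval w mem args = x + y := by
  rw [eval, ha, hb, Op.eval, Nat.mod_eq_of_lt h]

theorem eval_sub (ha : a.eval w mem args = x) (hb : b.eval w mem args = y) (hyx : y ≤ x)
    (h : x < 2 ^ w) : (op .sub a b).eval w mem args = x - y := by
  rw [eval, ha, hb, Op.eval, Nat.mod_eq_of_lt (hyx.trans_lt h),
    show x + (2 ^ w - y) = x - y + 2 ^ w by omega, Nat.add_mod_right,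
    Nat.mod_eq_of_lt (by omega)]

theorem eval_mul (ha : a.eval w mem args = x) (hb : b.eval w mem args = y) (h : x * y < 2 ^ w) :
    (op .mul a b).eval w mem args = x * y := by
  rw [eval, ha, hb, Op.eval, Nat.mod_eq_of_lt h]

theorem eval_div (ha : a.eval w mem args = x) (hb : b.eval w mem args = y) (h : x < 2 ^ w) :
    (op .div a b).eval w mem args = x / y := by
  rw [eval, ha, hb, Op.eval, Nat.mod_eq_of_lt ((Nat.div_le_self _ _).trans_lt h)]

theorem eval_mod (ha : a.eval w mem args = x) (hb : b.eval w mem args = y) (h : x < 2 ^ w) :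
    (op .mod a b).eval w mem args = x % y := by
  rw [eval, ha, hb, Op.eval, Nat.mod_eq_of_lt ((Nat.mod_le _ _).trans_lt h)]

theorem eval_lt (ha : a.eval w mem args = x) (hb : b.eval w mem args = y) (h : 1 < 2 ^ w) :
    (lt a b).eval w mem args = if x < y then 1 else 0 := by
  rw [eval, ha, hb, Nat.mod_eq_of_lt h]

/-- The conjunction of a truth value and a word, which matters only in the true case. -/
theorem eval_guard {p : Prop} [Decidable p] (ha : a.eval w mem args = if p then 1 else 0)
    (hb : p → b.eval w mem args = x) (h : x < 2 ^ w) :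
    (op .mul a b).eval w mem args = if p then x else 0 := by
  rw [eval, ha]
  split_ifs with hp
  · rw [hb hp, Op.eval, one_mul, Nat.mod_eq_of_lt h]
  · simp [Op.eval]

theorem eval_and {p q : Prop} [Decidable p] [Decidable q]
    (ha : a.eval w mem args = if p then 1 else 0)
    (hb : p → b.eval w mem args = if q then 1 else 0) (h : 1 < 2 ^ w) :
    (op .mul a b).eval w mem args = if p ∧ q then 1 else 0 := by
  rw [eval_guard ha hb (by split_ifs <;> omega), ite_and]

/-- The truth value of an equation. -/
def eq (a b : Expr) : Expr := lt (op .add (lt a b) (lt b a)) (const 1)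

theorem eval_eq (ha : a.eval w mem args = x) (hb : b.eval w mem args = y) (h : 2 < 2 ^ w) :
    (eq a b).eval w mem args = if x = y then 1 else 0 := by
  rw [eq, eval_lt (eval_add (eval_lt ha hb (by omega)) (eval_lt hb ha (by omega))
    (by split_ifs <;> omega)) (eval_const (by omega)) (by omega)]
  split_ifs <;> omega

end

/-- The sum of finitely many expressions. -/
def sum : (k : ℕ) → (Fin k → Expr) → Expr
  | 0, _ => const 0
  | k + 1, f => op .add (f 0) (sum k fun i => f i.succ)

/-- The conjunction of finitely many truth values. -/
def all : (k : ℕ) → (Fin k → Expr) → Expr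
  | 0, _ => const 1
  | k + 1, f => op .mul (f 0) (all k fun i => f i.succ)

/-- The bitwise disjunction of finitely many expressions. -/
def or : (k : ℕ) → (Fin k → Expr) → Expr
  | 0, _ => const 0
  | k + 1, f => op .or (f 0) (or k fun i => f i.succ)

variable {w : ℕ} {mem args : ℕ → ℕ}

theorem eval_sum {k : ℕ} {f : Fin k → Expr} {x : Fin k → ℕ}
    (hf : ∀ i, (f i).eval w mem args = x i) (h : ∑ i, x i < 2 ^ w) :
    (sum k f).eval w mem args = ∑ i, x i := by
  induction k with
  | zero => simp [sum, eval]
  | succ k ih =>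
    rw [Fin.sum_univ_succ] at h ⊢
    exact eval_add (hf 0) (ih (fun i => hf i.succ) (by omega)) h

theorem eval_all {k : ℕ} {f : Fin k → Expr} {p : Fin k → Prop} [∀ i, Decidable (p i)]
    (hf : ∀ i, (f i).eval w mem args = if p i then 1 else 0) (h : 1 < 2 ^ w) :
    (all k f).eval w mem args = if ∀ i, p i then 1 else 0 := by
  induction k with
  | zero => simp [all, eval_const h]
  | succ k ih =>
    rw [all, eval_and (hf 0) (fun _ => ih fun i => hf i.succ) h]
    simp only [Fin.forall_fin_succ]

/-- All successful terms carry the same word, and bitwise disjunction is idempotent, so the number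
of successes does not matter, as it would for a sum. -/
theorem eval_or {k : ℕ} {f : Fin k → Expr} {p : Fin k → Prop} [∀ i, Decidable (p i)] {x : ℕ}
    (hf : ∀ i, (f i).eval w mem args = if p i then x else 0) (h : x < 2 ^ w) :
    (or k f).eval w mem args = if ∃ i, p i then x else 0 := by
  induction k with
  | zero => simp [or, eval]
  | succ k ih =>
    rw [or, eval, hf 0, ih fun i => hf i.succ, Op.eval]
    simp only [Fin.exists_fin_succ]
    by_cases h0 : p 0 <;> by_cases h1 : ∃ i : Fin k, p i.succ <;>
      simp [h0, h1, Nat.mod_eq_of_lt h]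

end WordRAM.Expr

namespace IPM

open WordRAM WordRAM.Expr

/-! ### The layout of the tables in memory -/

/-- The number of tables. -/
def tableCount : ℕ := 79

/-- The memory that holds the first `L` entries of each table, interleaved. -/
def layout (w : ℕ) (tables : ℕ → ℕ → ℕ) (L : ℕ) : List ℕ :=
  (List.range (tableCount * L)).map fun a => tables (a % tableCount) (a / tableCount) % 2 ^ w

/-- The entry of table `j` at the index `e`. -/
def entry (j : ℕ) (e : Expr) : Expr :=
  .load (.op .add (.op .mul e (.const tableCount)) (.const j))

theorem eval_entry {w L : ℕ} {tables : ℕ → ℕ → ℕ} {args : List ℕ} {j i : ℕ} {e : Expr}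
    (hL : tableCount * L < 2 ^ w)
    (he : e.eval w (start (layout w tables L) args).mem (start (layout w tables L) args).reg = i)
    (hi : i < L) (hj : j < tableCount) (ht : tables j i < 2 ^ w) :
    (entry j e).eval w (start (layout w tables L) args).mem (start (layout w tables L) args).reg =
      tables j i := by
  have h1 : i * tableCount + j < tableCount * L := by
    have := Nat.mul_le_mul_left tableCount (Nat.succ_le_of_lt hi)
    rw [Nat.mul_succ, mul_comm tableCount i] at this
    omega
  have hT : 0 < tableCount := by simp [tableCount]
  have hc : tableCount ≤ tableCount * L := Nat.le_mul_of_pos_right _ (by omega)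
  rw [entry, Expr.eval, eval_add (eval_mul he (eval_const (by omega)) (by omega))
    (eval_const (by omega)) (by omega)]
  simp only [start, layout, List.getD_eq_getElem?_getD, List.getElem?_map, List.getElem?_range h1,
    Option.map_some, Option.getD_some]
  rw [mul_comm i, Nat.mul_add_mod, Nat.mul_add_div hT, Nat.mod_eq_of_lt hj, Nat.div_eq_of_lt hj,
    add_zero, Nat.mod_eq_of_lt ht]

/-- The tables used by the query algorithm. -/
def tables (N p U : ℕ) (lev rep cls B disp tab : ℕ → ℕ) (H : Fin 8 → ℕ → ℕ)
    (M : Fin 8 → Fin 8 → ℕ → ℕ) (j : ℕ) : ℕ → ℕ :=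
  if j = 0 then lev else if j = 1 then rep else if j = 2 then cls else if j = 3 then B
  else if j = 4 then disp else if j = 5 then tab
  else if j = 6 then fun i => if i = 0 then N else if i = 1 then p else U
  -- Eight tables of prefix coordinates, then 64 of entries of the matrices of multiplication by
  -- powers.
  else if j < 15 then H (Fin.ofNat 8 (j - 7))
  else M (Fin.ofNat 8 ((j - 15) / 8)) (Fin.ofNat 8 ((j - 15) % 8))

/-! ### The query algorithm -/

namespace Query

def patStart : Expr := .op .sub (.arg 0) (.const 1)
def patLen : Expr := .op .sub (.op .add (.arg 1) (.const 1)) (.arg 0)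
def textStart : Expr := .op .sub (.arg 2) (.const 1)
def textLen : Expr := .op .sub (.op .add (.arg 3) (.const 1)) (.arg 2)

/-- The level of the pattern. -/
def level : Expr := entry 0 patLen

/-- The number of the block `0` of the level. -/
def levelBase : Expr := .op .div (entry 6 (.const 0)) level

/-- The number of the first block of the level that starts inside the pattern. -/
def patBlock : Expr :=
  .op .add levelBase (.op .div (.op .sub (.op .add patStart level) (.const 1)) level)

/-- The offset in the pattern of its sample position. -/
def offset : Expr := .op .sub (entry 1 patBlock) patStart

/-- The number of the block `j` of the text. -/
def textBlock (j : ℕ) : Expr :=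
  .op .add levelBase (.op .add (.op .div textStart level) (.const j))

/-- The position that the dictionary gives for the sample of the pattern in block `j` of the text;
it need not be meaningful. -/
def candidate (j : ℕ) : Expr :=
  entry 5 (.op .add
    (entry 4 (.op .mod (.op .add (entry 2 patBlock) (entry 3 (textBlock j))) (entry 6 (.const 2))))
    (textBlock j))

/-- Whether the candidate yields an occurrence that does not leave the text. -/
def inText (j : ℕ) : Expr :=
  let bound := .op .add (.op .add textStart offset) (.op .add textLen (.const 1))
  -- The candidate may be any word; the first test ensures that the additions in the later ones do
  -- not wrap around.
  .op .mul (.lt (candidate j) bound) (.op .mul (.lt (.op .add (candidate j) patLen) bound)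
    (.lt (.op .add textStart offset) (.op .add (candidate j) (.const 1))))

/-- One side of the test for the equality of two fragments of equal length. -/
def fingerprint (a b len : Expr) (t : Fin 8) : Expr :=
  .op .mod (.op .add (entry (7 + t) (.op .add a len))
    (.sum 8 fun i => .op .mul (entry (7 + i) b) (entry (15 + (8 * i + t)) len)))
    (entry 6 (.const 1))

/-- Whether the fragments of length `len` at the positions `a` and `b` are equal. -/
def sameFragment (a b len : Expr) : Expr :=
  .all 8 fun t => .eq (fingerprint a b len t) (fingerprint b a len t)

/-- The position in the text of the occurrence given by block `j`, or `0`. -/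
def result (j : ℕ) : Expr :=
  .op .mul (inText j) (.op .mul
    (sameFragment patStart (.op .sub (candidate j) offset) patLen)
    (.op .sub (.op .add (candidate j) (.const 1)) (.op .add textStart offset)))

/-- The position of the occurrence of the pattern in the text, or `0`. -/
def answer : Expr := .or 13 fun j => result j

end Query

end IPM

/-! ### Correctness of the query -/

namespace IPM

open WordRAM WordRAM.Expr

theorem mem_occurrences_iff {α : Type*} {x y : List α} {p : ℕ} :
    p ∈ occurrences x y ↔ ∃ k, p = k + 1 ∧ k + x.length ≤ y.length ∧
      (y.drop k).take x.length = x := by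
  constructor
  · rintro ⟨s, t, rfl, rfl⟩
    exact ⟨s.length, rfl, by simp, by simp⟩
  · rintro ⟨k, rfl, hk, hx⟩
    refine ⟨y.take k, y.drop (k + x.length), ?_, ?_⟩
    · have h : (y.drop k).take x.length ++ y.drop (k + x.length) = y.drop k := by
        rw [← List.drop_drop, List.take_append_drop]
      rw [hx] at h
      rw [List.append_assoc, h, List.take_append_drop]
    · rw [List.length_take, min_eq_left (by omega)]

theorem length_fragment {α : Type*} {v : List α} {i j : ℕ} (hi : 1 ≤ i) (hij : i ≤ j)
    (hj : j ≤ v.length) : (fragment v i j).length = j + 1 - i := by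
  simp only [fragment, List.length_take, List.length_drop]; omega

/-- The occurrence at position `q` of the pattern of length `L` at position `l` lies in the text of
length `L'` at position `l'`; all positions are numbered from `0`. -/
def OccursAt {α : Type*} (v : List α) (l L l' L' q : ℕ) : Prop :=
  l' ≤ q ∧ q + L ≤ l' + L' ∧ (v.drop l).take L = (v.drop q).take L

theorem mem_occurrences_fragment_iff {α : Type*} {v : List α} {l r l' r' p : ℕ} (hl : 1 ≤ l)
    (hlr : l ≤ r) (hr : r ≤ v.length) (hl' : 1 ≤ l') (hlr' : l' ≤ r') (hr' : r' ≤ v.length) :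
    p ∈ occurrences (fragment v l r) (fragment v l' r') ↔
      ∃ q, OccursAt v (l - 1) (r + 1 - l) (l' - 1) (r' + 1 - l') q ∧ p = q + 1 - (l' - 1) := by
  rw [mem_occurrences_iff, length_fragment hl hlr hr, length_fragment hl' hlr' hr']
  have key : ∀ k, k + (r + 1 - l) ≤ r' + 1 - l' →
      ((fragment v l' r').drop k).take (r + 1 - l) =
        (v.drop (l' - 1 + k)).take (r + 1 - l) := fun k hk => by
    rw [fragment, List.drop_take, List.take_take, List.drop_drop, min_eq_left (by omega)]
  constructor
  · rintro ⟨k, rfl, hk, h⟩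
    rw [key k hk] at h
    exact ⟨l' - 1 + k, ⟨by omega, by omega, h.symm⟩, by omega⟩
  · rintro ⟨q, ⟨h1, h2, h3⟩, rfl⟩
    refine ⟨q - (l' - 1), by omega, by omega, ?_⟩
    rw [key _ (by omega), show l' - 1 + (q - (l' - 1)) = q by omega, ← h3]
    rfl

/-- In a square-free word a text at most twice as long as the pattern contains the pattern at most
once. -/
theorem SquareFree.occursAt_unique {α : Type*} {v : List α} (hv : SquareFree v)
    {l L l' L' q q' : ℕ} (hL' : L' ≤ 2 * L) (h : l' + L' ≤ v.length)
    (hq : OccursAt v l L l' L' q) (hq' : OccursAt v l L l' L' q') : q = q' := by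
  obtain ⟨h1, h2, h3⟩ := hq
  obtain ⟨h1', h2', h3'⟩ := hq'
  exact hv.eq_of_take_drop_eq (by omega) (by omega) (h3.symm.trans h3') (by omega) (by omega)

/-- The tables `t` hold an index for the word `v`: the tables of `SquareFree.exists_index` and the
fingerprints of `exists_fingerprint`. -/
structure IsIndex {α : Type*} (v : List α) (t : ℕ → ℕ → ℕ) : Prop where
  base_le : t 6 0 ≤ 2 * v.length
  prime_pos : 0 < t 6 1
  prime_sq_le : t 6 1 ^ 2 ≤ 16 * (v.length + 1)
  level_spec : ∀ L, 0 < L → 0 < t 0 L ∧ 3 * t 0 L ≤ L + 2 ∧ L ≤ 6 * t 0 L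
  modulus_eq : t 6 2 = 8 * v.length
  class_lt : ∀ x, t 2 x < 8 * v.length
  shift_lt : ∀ x, t 3 x < 8 * v.length
  disp_le : ∀ x, t 4 x ≤ 2 * (8 * v.length)
  dict_le : ∀ x, t 5 x ≤ v.length
  sample_spec : ∀ l L, 0 < L → l + L ≤ v.length →
    let m := t 0 L
    let h := t 6 0 / m + (l + m - 1) / m
    l ≤ t 1 h ∧ t 1 h < l + L ∧
    ∀ q, q + L ≤ v.length → (v.drop l).take L = (v.drop q).take L →
      let s := q + (t 1 h - l)
      t 5 (t 4 ((t 2 h + t 3 (t 6 0 / m + s / m)) % (8 * v.length)) + (t 6 0 / m + s / m)) = s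
  prefix_lt : ∀ (i : Fin 8) x, t (7 + i) x < t 6 1
  power_lt : ∀ (i k : Fin 8) x, t (15 + (8 * i + k)) x < t 6 1
  fingerprint_spec : ∀ a b L, a + L ≤ v.length → b + L ≤ v.length →
    ((v.drop a).take L = (v.drop b).take L ↔ ∀ k : Fin 8,
      (t (7 + k) (a + L) + ∑ i : Fin 8, t (7 + i) b * t (15 + (8 * i + k)) L) % t 6 1 =
        (t (7 + k) (b + L) + ∑ i : Fin 8, t (7 + i) a * t (15 + (8 * i + k)) L) % t 6 1)

theorem SquareFree.exists_isIndex {α : Type*} {v : List α} (hv : SquareFree v)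
    (hn : 0 < v.length) : ∃ t, IsIndex v t := by
  obtain ⟨N, lev, rep, cls, B, disp, tab, hN, hlev, hcls, hB, hdisp, htab, hsample⟩ :=
    hv.exists_index hn
  obtain ⟨p, H, M, hp, hp2, hH, hM, hfp⟩ := exists_fingerprint v
  let t := tables N p (8 * v.length) lev rep cls B disp tab H M
  have tH : ∀ i : Fin 8, t (7 + i) = H i := by intro i; fin_cases i <;> rfl
  have tM : ∀ i k : Fin 8, t (15 + (8 * i + k)) = M i k := by
    intro i k; fin_cases i <;> fin_cases k <;> rfl
  refine ⟨t, hN, hp, hp2, hlev, rfl, hcls, hB, hdisp, htab, hsample, fun i x => ?_,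
    fun i k x => ?_, fun a b L ha hb => ?_⟩
  · rw [tH]; exact hH i x
  · rw [tM]; exact hM i k x
  · simp only [tH, tM]; exact hfp a b L ha hb

section
variable {α : Type*} {v : List α} {t : ℕ → ℕ → ℕ} {w : ℕ} {args : List ℕ}

/-- No operation wraps around: each product of two residues is at most `p ^ 2 ≤ 16 * (n + 1)`, so
eight of them plus one more residue stay well below `2 ^ w`. -/
theorem IsIndex.eval_sameFragment (ht : IsIndex v t) (hw : 4000 * (v.length + 1) ≤ 2 ^ w)
    (hn : 0 < v.length) {ea eb eL : Expr} {a b L : ℕ}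
    (ha : ea.eval w (start (layout w t (32 * v.length)) args).mem
      (start (layout w t (32 * v.length)) args).reg = a)
    (hb : eb.eval w (start (layout w t (32 * v.length)) args).mem
      (start (layout w t (32 * v.length)) args).reg = b)
    (hL : eL.eval w (start (layout w t (32 * v.length)) args).mem
      (start (layout w t (32 * v.length)) args).reg = L)
    (haL : a + L ≤ v.length) (hbL : b + L ≤ v.length)
    [Decidable ((v.drop a).take L = (v.drop b).take L)] :
    (Query.sameFragment ea eb eL).eval w (start (layout w t (32 * v.length)) args).mem
      (start (layout w t (32 * v.length)) args).reg =
      if (v.drop a).take L = (v.drop b).take L then 1 else 0 := by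
  set n := v.length
  have hD : tableCount * (32 * n) < 2 ^ w := by simp only [tableCount]; omega
  have hp := ht.prime_pos
  have hp2 := ht.prime_sq_le
  have hpn : t 6 1 ≤ 16 * (n + 1) := (Nat.le_self_pow (by norm_num) _).trans hp2
  have key : ∀ {ea eb : Expr} {a b : ℕ},
      ea.eval w (start (layout w t (32 * n)) args).mem
        (start (layout w t (32 * n)) args).reg = a →
      eb.eval w (start (layout w t (32 * n)) args).mem
        (start (layout w t (32 * n)) args).reg = b → a + L ≤ n → b + L ≤ n → ∀ k : Fin 8,
      (Query.fingerprint ea eb eL k).eval w (start (layout w t (32 * n)) args).mem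
        (start (layout w t (32 * n)) args).reg =
      (t (7 + k) (a + L) + ∑ i : Fin 8, t (7 + i) b * t (15 + (8 * i + k)) L) % t 6 1 := by
    intro ea eb a b ha hb haL hbL k
    have hprod : ∀ i : Fin 8, t (7 + i) b * t (15 + (8 * i + k)) L ≤ 16 * (n + 1) := fun i =>
      (Nat.mul_le_mul (ht.prefix_lt i b).le (ht.power_lt i k L).le).trans
        ((sq (t 6 1)).symm.le.trans hp2)
    have hsum : ∑ i : Fin 8, t (7 + i) b * t (15 + (8 * i + k)) L ≤ 128 * (n + 1) :=
      (Finset.sum_le_card_nsmul _ _ _ fun i _ => hprod i).trans (by simp; omega)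
    have hk := ht.prefix_lt k (a + L)
    refine eval_mod (eval_add (eval_entry hD (eval_add ha hL (by omega)) (by omega)
      (by simp only [tableCount]; omega) (by omega)) (eval_sum (fun i => ?_) (by omega)) (by omega))
      (eval_entry hD (eval_const (by omega)) (by omega) (by simp [tableCount]) (by omega)) (by omega)
    have h1 := ht.prefix_lt i b
    have h2 := ht.power_lt i k L
    have h3 := hprod i
    exact eval_mul (eval_entry hD hb (by omega) (by simp only [tableCount]; omega) (by omega))
      (eval_entry hD hL (by omega) (by simp only [tableCount]; omega) (by omega)) (by omega)
  classical
  rw [Query.sameFragment, eval_all (fun k => eval_eq (key ha hb haL hbL k) (key hb ha hbL haL k)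
    (by omega)) (by omega)]
  exact if_congr (ht.fingerprint_spec a b L haL hbL).symm rfl rfl

/-- Verification makes every accepted candidate a true occurrence, uniqueness makes all of them
agree, and the dictionary guarantees that the block containing the sample of a true occurrence
yields it. -/
theorem IsIndex.eval_answer (ht : IsIndex v t) (hv : SquareFree v)
    (hw : 4000 * (v.length + 1) ≤ 2 ^ w) {l r l' r' : ℕ} (hl : 1 ≤ l) (hlr : l ≤ r)
    (hr : r ≤ v.length) (hl' : 1 ≤ l') (hlr' : l' ≤ r') (hr' : r' ≤ v.length)
    (hlen : r' + 1 - l' ≤ 2 * (r + 1 - l)) :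
    ∃ x, Query.answer.eval w (start (layout w t (32 * v.length)) [l, r, l', r']).mem
        (start (layout w t (32 * v.length)) [l, r, l', r']).reg = x ∧ x < 2 ^ w ∧
      ((x = 0 ∧ ∀ q, ¬ OccursAt v (l - 1) (r + 1 - l) (l' - 1) (r' + 1 - l') q) ∨
        ∃ q, OccursAt v (l - 1) (r + 1 - l) (l' - 1) (r' + 1 - l') q ∧ x = q + 1 - (l' - 1)) := by
  classical
  set n := v.length
  have hn : 0 < n := by omega
  -- Addresses reach `79 * 32 * n = 2528 * n`, hence the constant 4000. Length `32 * n` accommodates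
  -- the largest index of a meaningful lookup, a displacement up to `16 * n` plus a block number up
  -- to `3 * n`.
  have hD : tableCount * (32 * n) < 2 ^ w := by simp only [tableCount]; omega
  obtain ⟨L, hLdef⟩ : ∃ L, L = r + 1 - l := ⟨_, rfl⟩
  obtain ⟨L', hLdef'⟩ : ∃ L', L' = r' + 1 - l' := ⟨_, rfl⟩
  obtain ⟨a, hadef⟩ : ∃ a, a = l - 1 := ⟨_, rfl⟩
  obtain ⟨a', hadef'⟩ : ∃ a', a' = l' - 1 := ⟨_, rfl⟩
  rw [← hLdef, ← hLdef', ← hadef, ← hadef']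
  set mem := (start (layout w t (32 * n)) [l, r, l', r']).mem with hmem
  set reg := (start (layout w t (32 * n)) [l, r, l', r']).reg with hreg
  have e0 : (arg 0).eval w mem reg = l := eval_arg rfl (by omega)
  have e1 : (arg 1).eval w mem reg = r := eval_arg rfl (by omega)
  have e2 : (arg 2).eval w mem reg = l' := eval_arg rfl (by omega)
  have e3 : (arg 3).eval w mem reg = r' := eval_arg rfl (by omega)
  have c1 : (const 1).eval w mem reg = 1 := eval_const (by omega)
  have ea : Query.patStart.eval w mem reg = a := by
    rw [hadef]; exact eval_sub e0 c1 (by omega) (by omega)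
  have eL : Query.patLen.eval w mem reg = L := by
    rw [hLdef]; exact eval_sub (eval_add e1 c1 (by omega)) e0 (by omega) (by omega)
  have ea' : Query.textStart.eval w mem reg = a' := by
    rw [hadef']; exact eval_sub e2 c1 (by omega) (by omega)
  have eL' : Query.textLen.eval w mem reg = L' := by
    rw [hLdef']; exact eval_sub (eval_add e3 c1 (by omega)) e2 (by omega) (by omega)
  obtain ⟨hm0, hm3, hm6⟩ := ht.level_spec L (by omega)
  obtain ⟨hs1, hs2, hs3⟩ := ht.sample_spec a L (by omega) (by omega)
  have em : Query.level.eval w mem reg = t 0 L :=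
    eval_entry hD eL (by omega) (by simp [tableCount]) (by omega)
  set m := t 0 L with hm
  have hNm : t 6 0 / m ≤ 2 * n := (Nat.div_le_self _ _).trans ht.base_le
  have eNm : Query.levelBase.eval w mem reg = t 6 0 / m := by
    have := ht.base_le
    exact eval_div (eval_entry hD (eval_const (by omega)) (by omega) (by simp [tableCount])
      (by omega)) em (by omega)
  obtain ⟨b₀, hb₀⟩ : ∃ b₀, b₀ = t 6 0 / m := ⟨_, rfl⟩
  rw [← hb₀] at hNm eNm hs1 hs2 hs3
  have hg : (a + m - 1) / m ≤ n := (Nat.div_le_self _ _).trans (by omega)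
  have eh : Query.patBlock.eval w mem reg = b₀ + (a + m - 1) / m :=
    eval_add eNm (eval_div (eval_sub (eval_add ea em (by omega)) c1 (by omega) (by omega)) em
      (by omega)) (by omega)
  obtain ⟨h, hh⟩ : ∃ h, h = b₀ + (a + m - 1) / m := ⟨_, rfl⟩
  rw [← hh] at hs1 hs2 hs3 eh
  have hhn : h ≤ 3 * n := by omega
  have eoff : Query.offset.eval w mem reg = t 1 h - a :=
    eval_sub (eval_entry hD eh (by omega) (by simp [tableCount]) (by omega)) ea hs1 (by omega)
  obtain ⟨d, hd⟩ : ∃ d, d = t 1 h - a := ⟨_, rfl⟩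
  rw [← hd] at hs3 eoff
  have edict : ∀ (j q : ℕ), OccursAt v a L a' L' q → j < 13 → (q + d) / m = a' / m + j →
      (Query.candidate j).eval w mem reg = q + d := by
    intro j q hq hj hqj
    obtain ⟨hq1, hq2, hq3⟩ := hq
    have hq4 := hs3 q (by omega) hq3
    have hb : (q + d) / m ≤ n := (Nat.div_le_self _ _).trans (by omega)
    have ej : (Query.textBlock j).eval w mem reg = b₀ + (q + d) / m := by
      rw [hqj] at hb ⊢
      exact eval_add eNm (eval_add (eval_div ea' em (by omega)) (eval_const (by omega)) (by omega))
        (by omega)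
    have h2 := ht.class_lt h
    have h3 := ht.shift_lt (b₀ + (q + d) / m)
    have h4 := ht.disp_le ((t 2 h + t 3 (b₀ + (q + d) / m)) % (8 * v.length))
    have h5 : (t 2 h + t 3 (b₀ + (q + d) / m)) % (8 * v.length) < 8 * v.length :=
      Nat.mod_lt _ (by omega)
    have h6 := ht.modulus_eq
    have erow := eval_mod (eval_add (eval_entry hD eh (by omega) (by simp [tableCount])
        (by omega) : (entry 2 Query.patBlock).eval w mem reg = t 2 h)
      (eval_entry (j := 3) hD ej (by omega) (by simp [tableCount]) (by omega)) (by omega))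
      (eval_entry hD (eval_const (by omega)) (by omega) (by simp [tableCount]) (by omega) :
        (entry 6 (.const 2)).eval w mem reg = t 6 2) (by omega)
    rw [h6] at erow
    have := eval_entry (j := 5) hD (eval_add (eval_entry (j := 4) hD erow (by omega)
      (by simp [tableCount]) (by omega)) ej (by omega)) (by omega) (by simp [tableCount])
      (by have := ht.dict_le; exact (this _).trans_lt (by omega))
    exact this.trans hq4
  -- Nothing is assumed of the candidate here: a lookup with an absent key may return any value.
  have eres : ∀ j, (Query.result j).eval w mem reg =
      let s := (Query.candidate j).eval w mem reg
      if a' + d ≤ s ∧ OccursAt v a L a' L' (s - d) then s + 1 - (a' + d) else 0 := by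
    intro j
    dsimp only
    obtain ⟨s, hs⟩ : ∃ s, (Query.candidate j).eval w mem reg = s := ⟨_, rfl⟩
    rw [hs]
    have ebound : (Expr.op .add (.op .add Query.textStart Query.offset)
        (.op .add Query.textLen (.const 1))).eval w mem reg = a' + d + (L' + 1) :=
      eval_add (eval_add ea' eoff (by omega)) (eval_add eL' c1 (by omega)) (by omega)
    have ein : (Query.inText j).eval w mem reg = if s < a' + d + (L' + 1) ∧
        s + L < a' + d + (L' + 1) ∧ a' + d < s + 1 then 1 else 0 :=
      eval_and (eval_lt hs ebound (by omega)) (fun hp => eval_and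
        (eval_lt (eval_add hs eL (by omega)) ebound (by omega))
        (fun _ => eval_lt (eval_add ea' eoff (by omega)) (eval_add hs c1 (by omega)) (by omega))
        (by omega)) (by omega)
    by_cases hin : s < a' + d + (L' + 1) ∧ s + L < a' + d + (L' + 1) ∧ a' + d < s + 1
    · have := eval_guard (x := if (v.drop a).take L = (v.drop (s - d)).take L then
          s + 1 - (a' + d) else 0) ein (fun _ => eval_guard
          (ht.eval_sameFragment hw hn ea (eval_sub hs eoff (by omega) (by omega)) eL
            (by omega) (by omega))
          (fun _ => eval_sub (eval_add hs c1 (by omega)) (eval_add ea' eoff (by omega))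
            (by omega) (by omega)) (by omega)) (by split_ifs <;> omega)
      refine this.trans ?_
      rw [if_pos hin]
      refine if_congr ?_ rfl rfl
      exact ⟨fun h => ⟨by omega, by omega, by omega, h⟩, fun h => h.2.2.2⟩
    · have := eval_guard (x := 0) ein (b := .op .mul
        (Query.sameFragment Query.patStart (.op .sub (Query.candidate j) Query.offset) Query.patLen)
        (.op .sub (.op .add (Query.candidate j) (.const 1))
          (.op .add Query.textStart Query.offset))) (fun hp => absurd hp hin) (by omega)
      refine this.trans ?_
      rw [ite_self, if_neg]
      rintro ⟨h1, h2, h3, h4⟩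
      omega
  by_cases hocc : ∃ q, OccursAt v a L a' L' q
  · obtain ⟨q, hq⟩ := hocc
    have hq' := hq
    obtain ⟨hq1, hq2, hq3⟩ := hq'
    have eor : Query.answer.eval w mem reg =
        if ∃ j : Fin 13, (Query.candidate j).eval w mem reg = q + d then q + 1 - a' else 0 := by
      refine eval_or (fun j => ?_) (by omega)
      rw [eres j]
      dsimp only
      by_cases hj : (Query.candidate j).eval w mem reg = q + d
      · rw [if_pos hj, if_pos, hj]
        · omega
        · rw [hj, Nat.add_sub_cancel]
          exact ⟨by omega, hq⟩
      · rw [if_neg hj, if_neg]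
        rintro ⟨h1, h2⟩
        have := hv.occursAt_unique (by omega) (by omega) hq h2
        omega
    refine ⟨_, eor, by split_ifs <;> omega, Or.inr ⟨q, hq, if_pos ?_⟩⟩
    have h1 : a' / m ≤ (q + d) / m := Nat.div_le_div_right (by omega)
    -- The sample lies inside the text, so `q + d < a' + L' ≤ a' + 2 * L ≤ a' + 12 * m`; this gives
    -- the 13 blocks.
    have h2 : (q + d) / m ≤ a' / m + 12 := by
      rw [← Nat.add_mul_div_right _ _ hm0]
      exact Nat.div_le_div_right (by omega)
    exact ⟨⟨(q + d) / m - a' / m, by omega⟩,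
      edict _ q hq (by dsimp only; omega) (by dsimp only; omega)⟩
  · refine ⟨0, ?_, by omega, Or.inl ⟨rfl, fun q hq => hocc ⟨q, hq⟩⟩⟩
    have eor : Query.answer.eval w mem reg = if ∃ j : Fin 13, False then 0 else 0 :=
      eval_or (fun j => by
        rw [eres j, if_neg (fun h => hocc ⟨_, h.2⟩), ite_self]) (by omega)
    simpa using eor

end

end IPM

/-! ### Assembling the data structure and the program -/

theorem mainTheorem6 :
    ∃ (P : WordRAM.Program) (c C T : ℕ), ∀ (α : Type*) (v : List α) (w : ℕ),
      IPM.SquareFree v → c * (v.length + 1) ≤ 2 ^ w →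
      ∃ D : List ℕ, D.length ≤ C * v.length ∧ (∀ a ∈ D, a < 2 ^ w) ∧
        IPM.AnswersQueries w P T D v := by
  open WordRAM IPM in
  -- The progression has at most one term, so difference 0 is allowed. Positions in the text count
  -- from 1, so the answer 0 means no occurrence and the number of terms is the truth value of `0 <
  -- x`.
  obtain ⟨P, T, hP⟩ := exists_program Query.answer (.const 0) (.lt (.const 0) Query.answer)
  refine ⟨P, 4000, tableCount * 32, T, fun α v w hv hw => ?_⟩
  rcases Nat.eq_zero_or_pos v.length with hn | hn
  · exact ⟨[], by simp, by simp, fun l r l' r' h1 h2 h3 => by omega⟩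
  obtain ⟨t, ht⟩ := hv.exists_isIndex hn
  refine ⟨layout w t (32 * v.length), ?_, ?_, ?_⟩
  · simp [layout, mul_assoc]
  · intro a ha
    obtain ⟨i, -, rfl⟩ := List.mem_map.1 ha
    exact Nat.mod_lt _ (Nat.two_pow_pos w)
  intro l r l' r' hl hlr hr hl' hlr' hr' hlen
  rw [length_fragment hl hlr hr, length_fragment hl' hlr' hr'] at hlen
  obtain ⟨k, hk, c, hc, hhalt, hmem, h0, h1, h2⟩ := hP w (layout w t (32 * v.length)) [l, r, l', r']
  obtain ⟨x, hx, hxw, hspec⟩ := ht.eval_answer hv hw hl hlr hr hl' hlr' hr' hlen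
  refine ⟨k, hk, c, hc, hhalt, hmem, ?_⟩
  rw [h0, h1, h2, Expr.eval_lt (Expr.eval_const (by omega)) hx (by omega), hx,
    Nat.mod_eq_of_lt hxw]
  have hset := fun p => mem_occurrences_fragment_iff (p := p) hl hlr hr hl' hlr' hr'
  rcases hspec with ⟨rfl, hno⟩ | ⟨q, hq, rfl⟩
  · refine ⟨Set.ext fun p => ?_, by simp⟩
    rw [hset]
    constructor
    · rintro ⟨q, hq, -⟩
      exact absurd hq (hno q)
    · rintro ⟨i, hi, -⟩
      simp at hi
  · have hpos : 0 < q + 1 - (l' - 1) := by have := hq.1; omega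
    rw [if_pos hpos, Nat.mod_eq_of_lt (show 1 < 2 ^ w by omega)]
    refine ⟨Set.ext fun p => ?_, by omega⟩
    rw [hset]
    constructor
    · rintro ⟨q', hq', rfl⟩
      rw [hv.occursAt_unique hlen (by omega) hq' hq]
      exact ⟨0, Nat.one_pos, by simp⟩
    · rintro ⟨i, hi, rfl⟩
      refine ⟨q, hq, ?_⟩
      rw [Nat.lt_one_iff.1 hi, zero_mul, add_zero]
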